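/- On $\mathbb{R}^5$ with coordinates $x_0,\dots,x_4$ and $\partial_i=\partial/\partial x_i$, let $$\lambda_0=dx_0-3x_2\,dx_3+x_1\,dx_4,$$ $$\Upsilon_0=-3\,dx_2^2dx_3^2+4\,dx_1dx_3^3+4\,dx_2^3dx_4-6\,dx_1dx_2dx_3dx_4+dx_1^2dx_4^2 .$$ Then $([\lambda_0],[\Upsilon_0])$ is a $G_2$-contact structure: locally the contact distribution $\ker\lambda_0$ can be smoothly identified with the space of binary cubics $S^3\mathbb{R}^2$ so that, up to nonvanishing factors, $\Upsilon_0$ becomes the discriminant and $d\lambda_0$ the $\mathfrak{gl}(2,\mathbb{R})$-invariant skew form. A smooth vector field $X$ on $\mathbb{R}^5$ is an infinitesimal symmetry of $([\lambda_0],[\Upsilon_0])$ if $(\mathcal L_X\lambda_0)\wedge\lambda_0=0$ and $\mathcal L_X\Upsilon_0=f\,\Upsilon_0+\lambda_0\odot\tau$ for some smooth function $f$ and smooth rank $3$ tensor $\tau$. Put $y_0=x_0-3x_2x_3$ and $y_i=x_i$ for $1\le i\le 4$. In these coordinates $\lambda_0=dy_0+3y_3\,dy_2+y_1\,dy_4$,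 and the coordinate fields $D_i=\partial/\partial y_i$ are $D_0=\partial_0$, $D_1=\partial_1$, $D_2=\partial_2+3x_3\partial_0$, $D_3=\partial_3+3x_2\partial_0$, $D_4=\partial_4$. Consider the 14 vector fields $$\begin{aligned} X_1&=(y_0^2+3y_3^3y_1-3y_3y_1y_4y_2-y_4y_2^3-3y_3^2y_2^2)D_0+(y_1^2y_4+y_0y_1+y_2^3)D_1\\&\quad+(2y_3y_2^2+y_2y_1y_4+y_0y_2-y_1y_3^2)D_2+(y_0y_3+y_2y_3^2+y_4y_2^2)D_3+(y_0y_4+3y_3y_2y_4-y_3^3)D_4,\\ X_2&=-(y_0y_4-2y_3^3)D_0+(y_1y_4+y_0)D_1-y_3^2D_2-y_3y_4D_3-y_4^2D_4,\\ X_3&=-(\tfrac12y_3y_1y_4+\tfrac12y_4y_2^2+y_2y_3^2)D_0+\tfrac12y_2^2D_1+(\tfrac23y_3y_2+\tfrac16y_1y_4+\tfrac16y_0)D_2+(\tfrac16y_3^2+\tfrac13y_2y_4)D_3+\tfrac12y_3y_4D_4,\\ X_4&=-(y_2y_4+y_3^2)D_0+y_2D_1+\tfrac23y_3D_2+\tfrac13y_4D_3,\\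 X_5&=-y_4D_0+D_1,\\ X_6&=(y_0y_2-2y_1y_3^2)D_0+y_1y_2D_1+(\tfrac13y_2^2+\tfrac23y_3y_1)D_2+(\tfrac13y_3y_2-\tfrac13y_0)D_3+y_3^2D_4,\\ X_7&=y_0D_0+y_1D_1+\tfrac23y_2D_2+\tfrac13y_3D_3,\\ X_8&=-(\tfrac32y_3y_1y_2+\tfrac12y_2^3)D_0+\tfrac12y_1^2D_1+\tfrac12y_1y_2D_2+\tfrac12y_2^2D_3+(\tfrac32y_3y_2+\tfrac12y_0)D_4,\\ X_9&=-(y_3y_1+y_2^2)D_0+\tfrac13y_1D_2+\tfrac23y_2D_3+y_3D_4,\\ X_{10}&=D_4,\\ X_{11}&=y_0D_0+\tfrac13y_2D_2+\tfrac23y_3D_3+y_4D_4,\\ X_{12}&=-3y_2D_0+D_3,\qquad X_{13}=D_2,\qquad X_{14}=D_0 . \end{aligned}$$ A smooth vector field on $\mathbb{R}^5$ is an infinitesimal symmetry of $([\lambda_0],[\Upsilon_0])$ if and only if it is a real linear combination of $X_1,\dots,X_{14}$. The Lie algebra generated by $X_1,\dots,X_{14}$ is their real linear span, and it is isomorphic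 to the split real form of the exceptional simple Lie algebra $\mathfrak g_2$, i.e. to the stabilizer in $\mathfrak{gl}(7,\mathbb{R})$ of the $3$-form of the imaginary split octonions $$\Phi=2e^{1}\wedge e^4\wedge e^7+e^1\wedge e^5\wedge e^6+8e^2\wedge e^3\wedge e^7-2e^2\wedge e^4\wedge e^6-2e^3\wedge e^4\wedge e^5 .$$ The $G_2$-contact structure $([\lambda_0],[\Upsilon_0])$ is flat: it is locally equivalent to the homogeneous model $G_2/\bar P$ with its canonical invariant $G_2$-contact structure, where $G_2\subset GL(7,\mathbb{R})$ is the stabilizer of $\Phi$ and $\bar P\subset G_2$ is the stabilizer of the plane $\mathrm{span}(e_1,e_2)$. -/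

import Mathlib

open scoped ContDiff

noncomputable section

namespace G2Contact

/-! ### Vector fields, tensors and Lie derivatives on `ℝ⁵` -/

/-- `ℝ⁵` with its coordinates `x₀, …, x₄`. -/
abbrev R5 := Fin 5 → ℝ

/-- The space `𝔛(ℝ⁵)` of smooth vector fields on `ℝ⁵`. -/
def SmoothVF : Submodule ℝ (R5 → R5) where
  carrier := {X | ContDiff ℝ ∞ X}
  add_mem' {X Y} (hX : ContDiff ℝ ∞ X) (hY : ContDiff ℝ ∞ Y) := show ContDiff ℝ ∞ (X + Y) from
    hX.add hY
  zero_mem' := show ContDiff ℝ ∞ (fun _ => 0) from contDiff_const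
  smul_mem' c X (hX : ContDiff ℝ ∞ X) := show ContDiff ℝ ∞ (c • X) from hX.const_smul c

theorem contDiff_coe (X : SmoothVF) : ContDiff ℝ ∞ (X : R5 → R5) := X.2

theorem differentiable_coe (X : SmoothVF) : Differentiable ℝ (X : R5 → R5) :=
  (contDiff_coe X).differentiable (by simp)

/-- The bracket of vector fields, `[X, Y] = DY · X - DX · Y`. -/
instance : Bracket SmoothVF SmoothVF where
  bracket X Y := ⟨VectorField.lieBracket ℝ (X : R5 → R5) (Y : R5 → R5),
    show ContDiff ℝ ∞ _ from
      ContDiff.lieBracket_vectorField (contDiff_coe X) (contDiff_coe Y) (m := ∞) (n := ∞) le_rfl⟩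

theorem coe_bracket (X Y : SmoothVF) :
    ((⁅X, Y⁆ : SmoothVF) : R5 → R5) = VectorField.lieBracket ℝ (X : R5 → R5) (Y : R5 → R5) :=
  rfl

instance : LieRing SmoothVF where
  add_lie X Y Z := by
    ext1; funext x
    exact VectorField.lieBracket_add_left (differentiable_coe X x) (differentiable_coe Y x)
  lie_add X Y Z := by
    ext1; funext x
    exact VectorField.lieBracket_add_right (differentiable_coe Y x) (differentiable_coe Z x)
  lie_self X := by
    ext1
    exact VectorField.lieBracket_self
  leibniz_lie X Y Z := by
    ext1; funext x
    have h : minSmoothness ℝ 2 ≤ (∞ : WithTop ℕ∞) := by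
      simp only [minSmoothness_of_isRCLikeNormedField]
      exact WithTop.coe_le_coe.2 (le_top : (2 : ℕ∞) ≤ ⊤)
    exact VectorField.leibniz_identity_lieBracket h (contDiff_coe X).contDiffAt
      (contDiff_coe Y).contDiffAt (contDiff_coe Z).contDiffAt

instance : LieAlgebra ℝ SmoothVF where
  lie_smul c X Y := by
    ext1; funext x
    exact VectorField.lieBracket_const_smul_right (differentiable_coe Y x)

/-- Smooth `1`-forms are maps of this type. -/
abbrev OneForm := R5 → (R5 →L[ℝ] ℝ)

/-- A symmetric covariant tensor field `T` of rank `k` on `ℝ⁵` is written as a homogeneous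
polynomial of degree `k` in the differentials `dx₀, …, dx₄`, that is, as the function
`T x v = T_x(v, …, v)` of the point `x` and the tangent vector `v`. -/
abbrev SymTensor := R5 → R5 → ℝ

/-- The Lie derivative of a symmetric covariant tensor field (of any rank, in particular of a
`1`-form): `(L_X T)(v, …, v) = X (T(v, …, v)) + ∑ T(v, …, DX · v, …, v)` for constant `v`; the sum
is the derivative of the polynomial `T x` at `v` in the direction `DX · v`. -/
def lieDeriv (X : R5 → R5) (T : SymTensor) : SymTensor := fun x v =>
  fderiv ℝ (fun y => T y v) x (X x) + fderiv ℝ (T x) v (fderiv ℝ X x v)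

/-- The exterior derivative of a `1`-form, `dα(u, v) = u(α(v)) - v(α(u))` for constant `u, v`. -/
def dOneForm (α : OneForm) (x u v : R5) : ℝ := fderiv ℝ α x u v - fderiv ℝ α x v u

/-- `X` is an infinitesimal symmetry of `([α], [Υ])`:  `(L_X α) ∧ α = 0` and
`L_X Υ = f Υ + α ⊙ τ` with a smooth function `f` and a smooth rank `3` tensor `τ` with
components `τ i j k`. -/
def IsInfinitesimalSymmetry (α : OneForm) (Υ : SymTensor) (X : R5 → R5) : Prop :=
  (∀ x u v, lieDeriv X (fun y w => α y w) x u * α x v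
      - lieDeriv X (fun y w => α y w) x v * α x u = 0) ∧
  ∃ (f : R5 → ℝ) (τ : Fin 5 → Fin 5 → Fin 5 → R5 → ℝ),
    ContDiff ℝ ∞ f ∧ (∀ i j k, ContDiff ℝ ∞ (τ i j k)) ∧
    ∀ x v, lieDeriv X Υ x v
      = f x * Υ x v + α x v * ∑ i, ∑ j, ∑ k, τ i j k x * (v i * v j * v k)

/-! ### The structure `([λ₀], [Υ₀])` and the fourteen vector fields -/

/-- The coordinate differential `dxᵢ`. -/
abbrev dx (i : Fin 5) : R5 →L[ℝ] ℝ := ContinuousLinearMap.proj i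

/-- `λ₀ = dx₀ - 3 x₂ dx₃ + x₁ dx₄`. -/
def lam0 : OneForm := fun x => dx 0 - (3 * x 2) • dx 3 + x 1 • dx 4

/-- `Υ₀ = -3 dx₂² dx₃² + 4 dx₁ dx₃³ + 4 dx₂³ dx₄ - 6 dx₁ dx₂ dx₃ dx₄ + dx₁² dx₄²`. -/
def ups0 : SymTensor := fun _ v =>
  -3 * v 2 ^ 2 * v 3 ^ 2 + 4 * v 1 * v 3 ^ 3 + 4 * v 2 ^ 3 * v 4
    - 6 * v 1 * v 2 * v 3 * v 4 + v 1 ^ 2 * v 4 ^ 2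

/-- The coefficients of the fourteen vector fields, as polynomials in the coordinates `y₀, …, y₄`;
the fields `X₁, …, X₁₄` are indexed by `0, …, 13`. -/
def coeff (y0 y1 y2 y3 y4 : ℝ) : Fin 14 → R5 :=
  ![![y0 ^ 2 + 3 * y3 ^ 3 * y1 - 3 * y3 * y1 * y4 * y2 - y4 * y2 ^ 3 - 3 * y3 ^ 2 * y2 ^ 2,
      y1 ^ 2 * y4 + y0 * y1 + y2 ^ 3,
      2 * y3 * y2 ^ 2 + y2 * y1 * y4 + y0 * y2 - y1 * y3 ^ 2,
      y0 * y3 + y2 * y3 ^ 2 + y4 * y2 ^ 2,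
      y0 * y4 + 3 * y3 * y2 * y4 - y3 ^ 3],
    ![-(y0 * y4 - 2 * y3 ^ 3), y1 * y4 + y0, -y3 ^ 2, -(y3 * y4), -y4 ^ 2],
    ![-(1 / 2 * y3 * y1 * y4 + 1 / 2 * y4 * y2 ^ 2 + y2 * y3 ^ 2), 1 / 2 * y2 ^ 2,
      2 / 3 * y3 * y2 + 1 / 6 * y1 * y4 + 1 / 6 * y0, 1 / 6 * y3 ^ 2 + 1 / 3 * y2 * y4,
      1 / 2 * y3 * y4],
    ![-(y2 * y4 + y3 ^ 2), y2, 2 / 3 * y3, 1 / 3 * y4, 0],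
    ![-y4, 1, 0, 0, 0],
    ![y0 * y2 - 2 * y1 * y3 ^ 2, y1 * y2, 1 / 3 * y2 ^ 2 + 2 / 3 * y3 * y1,
      1 / 3 * y3 * y2 - 1 / 3 * y0, y3 ^ 2],
    ![y0, y1, 2 / 3 * y2, 1 / 3 * y3, 0],
    ![-(3 / 2 * y3 * y1 * y2 + 1 / 2 * y2 ^ 3), 1 / 2 * y1 ^ 2, 1 / 2 * y1 * y2,
      1 / 2 * y2 ^ 2, 3 / 2 * y3 * y2 + 1 / 2 * y0],
    ![-(y3 * y1 + y2 ^ 2), 0, 1 / 3 * y1, 2 / 3 * y2, y3],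
    ![0, 0, 0, 0, 1],
    ![y0, 0, 1 / 3 * y2, 2 / 3 * y3, y4],
    ![-3 * y2, 0, 0, 1, 0],
    ![0, 0, 1, 0, 0],
    ![1, 0, 0, 0, 0]]

/-- The coordinates `y₀ = x₀ - 3 x₂ x₃`, `yᵢ = xᵢ` (`i = 1, …, 4`), in which
`λ₀ = dy₀ + 3 y₃ dy₂ + y₁ dy₄`, have the coordinate fields `∂/∂y₀ = ∂₀`, `∂/∂y₁ = ∂₁`,
`∂/∂y₂ = ∂₂ + 3 x₃ ∂₀`, `∂/∂y₃ = ∂₃ + 3 x₂ ∂₀`, `∂/∂y₄ = ∂₄`. -/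
def partialY (x : R5) : Fin 5 → R5 :=
  ![![1, 0, 0, 0, 0], ![0, 1, 0, 0, 0], ![3 * x 3, 0, 1, 0, 0], ![3 * x 2, 0, 0, 1, 0],
    ![0, 0, 0, 0, 1]]

/-- The fourteen vector fields `∑ᵢ coeffᵢ(y) ∂/∂yᵢ`. -/
def fieldFun (A : Fin 14) : R5 → R5 := fun x =>
  ∑ i, coeff (x 0 - 3 * x 2 * x 3) (x 1) (x 2) (x 3) (x 4) A i • partialY x i

set_option maxHeartbeats 1000000 in
theorem contDiff_coeff {y0 y1 y2 y3 y4 : R5 → ℝ} (h0 : ContDiff ℝ ∞ y0) (h1 : ContDiff ℝ ∞ y1)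
    (h2 : ContDiff ℝ ∞ y2) (h3 : ContDiff ℝ ∞ y3) (h4 : ContDiff ℝ ∞ y4) (A : Fin 14) (i : Fin 5) :
    ContDiff ℝ ∞ (fun x => coeff (y0 x) (y1 x) (y2 x) (y3 x) (y4 x) A i) := by
  fin_cases A <;> fin_cases i <;> simp [coeff] <;> fun_prop

theorem contDiff_fieldFun (A : Fin 14) : ContDiff ℝ ∞ (fieldFun A) := by
  unfold fieldFun
  refine ContDiff.sum fun i _ => ContDiff.fun_smul ?_ ?_
  · exact contDiff_coeff (by fun_prop) (by fun_prop) (by fun_prop) (by fun_prop) (by fun_prop) A i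
  · rw [contDiff_pi]
    intro j
    fin_cases i <;> fin_cases j <;> simp [partialY] <;> fun_prop

/-- The fourteen vector fields as elements of `𝔛(ℝ⁵)`. -/
def field (A : Fin 14) : SmoothVF := ⟨fieldFun A, contDiff_fieldFun A⟩

/-! ### The split real form of `G₂`, on the seven-dimensional space `𝕍 = ℝ⁷`

The basis `e₁, …, e₇` is indexed by `0, …, 6`. -/

abbrev V7 := Fin 7 → ℝ

/-- `eⁱ ∧ eʲ ∧ eᵏ`. -/
def wedge3 (i j k : Fin 7) (u v w : V7) : ℝ :=
  Matrix.det !![u i, u j, u k; v i, v j, v k; w i, w j, w k]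

/-- The `3`-form `Φ(X, Y, Z) = ⟨X · Y, Z⟩` of the imaginary split octonions:
`Φ = 2 e¹∧e⁴∧e⁷ + e¹∧e⁵∧e⁶ + 8 e²∧e³∧e⁷ - 2 e²∧e⁴∧e⁶ - 2 e³∧e⁴∧e⁵`. -/
def Phi (u v w : V7) : ℝ :=
  2 * wedge3 0 3 6 u v w + wedge3 0 4 5 u v w + 8 * wedge3 1 2 6 u v w
    - 2 * wedge3 1 3 5 u v w - 2 * wedge3 2 3 4 u v w

/-- The bilinear form `H = -2 e¹e⁷ - 2 e²e⁶ - 2 e³e⁵ - e⁴e⁴` of signature `(3, 4)`, invariant under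
the stabilizer of `Φ`. -/
def Hform (u v : V7) : ℝ :=
  -(u 0 * v 6 + u 6 * v 0) - (u 1 * v 5 + u 5 * v 1) - (u 2 * v 4 + u 4 * v 2) - u 3 * v 3

theorem Phi_add1 (u u' v w : V7) : Phi (u + u') v w = Phi u v w + Phi u' v w := by
  simp [Phi, wedge3, Matrix.det_fin_three]; ring

theorem Phi_add2 (u v v' w : V7) : Phi u (v + v') w = Phi u v w + Phi u v' w := by
  simp [Phi, wedge3, Matrix.det_fin_three]; ring

theorem Phi_add3 (u v w w' : V7) : Phi u v (w + w') = Phi u v w + Phi u v w' := by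
  simp [Phi, wedge3, Matrix.det_fin_three]; ring

theorem Phi_smul1 (c : ℝ) (u v w : V7) : Phi (c • u) v w = c * Phi u v w := by
  simp [Phi, wedge3, Matrix.det_fin_three]; ring

theorem Phi_smul2 (c : ℝ) (u v w : V7) : Phi u (c • v) w = c * Phi u v w := by
  simp [Phi, wedge3, Matrix.det_fin_three]; ring

theorem Phi_smul3 (c : ℝ) (u v w : V7) : Phi u v (c • w) = c * Phi u v w := by
  simp [Phi, wedge3, Matrix.det_fin_three]; ring

theorem Phi_sub1 (u u' v w : V7) : Phi (u - u') v w = Phi u v w - Phi u' v w := by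
  simp [Phi, wedge3, Matrix.det_fin_three]; ring

theorem Phi_sub2 (u v v' w : V7) : Phi u (v - v') w = Phi u v w - Phi u v' w := by
  simp [Phi, wedge3, Matrix.det_fin_three]; ring

theorem Phi_sub3 (u v w w' : V7) : Phi u v (w - w') = Phi u v w - Phi u v w' := by
  simp [Phi, wedge3, Matrix.det_fin_three]; ring

open Matrix in
/-- The split real form of the exceptional simple Lie group `G₂`: the stabilizer of `Φ` in
`GL(𝕍)`. -/
def G2Group : Subgroup (GL (Fin 7) ℝ) where
  carrier := {g | ∀ u v w, Phi (g.1 *ᵥ u) (g.1 *ᵥ v) (g.1 *ᵥ w) = Phi u v w}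
  mul_mem' {a b} ha hb u v w := by
    have h := ha (b.1 *ᵥ u) (b.1 *ᵥ v) (b.1 *ᵥ w)
    rw [hb u v w] at h
    simpa [Matrix.mulVec_mulVec] using h
  one_mem' u v w := by simp
  inv_mem' {a} ha u v w := by
    have hi : ∀ z : V7, a.1 *ᵥ ((a⁻¹).1 *ᵥ z) = z := fun z => by
      rw [Matrix.mulVec_mulVec, ← Units.val_mul, mul_inv_cancel]; simp
    have h := ha ((a⁻¹).1 *ᵥ u) ((a⁻¹).1 *ᵥ v) ((a⁻¹).1 *ᵥ w)
    rw [hi, hi, hi] at h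
    exact h.symm

attribute [local instance] LieRing.ofAssociativeRing

open Matrix in
/-- The split real form of the exceptional simple Lie algebra `𝔤₂`: the stabilizer of `Φ` in
`𝔤𝔩(𝕍)`. -/
def splitG2 : LieSubalgebra ℝ (Matrix (Fin 7) (Fin 7) ℝ) where
  carrier := {A | ∀ u v w, Phi (A *ᵥ u) v w + Phi u (A *ᵥ v) w + Phi u v (A *ᵥ w) = 0}
  add_mem' {A B} hA hB u v w := by
    simp only [Matrix.add_mulVec, Phi_add1, Phi_add2, Phi_add3]
    linear_combination hA u v w + hB u v w
  zero_mem' u v w := by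
    have h1 := Phi_smul1 0 u v w
    have h2 := Phi_smul2 0 u v w
    have h3 := Phi_smul3 0 u v w
    simp only [zero_smul, zero_mul] at h1 h2 h3
    simp [h1, h2, h3]
  smul_mem' c A hA u v w := by
    simp only [Matrix.smul_mulVec, Phi_smul1, Phi_smul2, Phi_smul3]
    linear_combination c * hA u v w
  lie_mem' {A B} hA hB := by
    intro u v w
    simp only [Ring.lie_def, Matrix.sub_mulVec, ← Matrix.mulVec_mulVec, Phi_sub1, Phi_sub2,
      Phi_sub3]
    linear_combination hA (B *ᵥ u) v w + hA u (B *ᵥ v) w + hA u v (B *ᵥ w)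
      - hB (A *ᵥ u) v w - hB u (A *ᵥ v) w - hB u v (A *ᵥ w)

/-! ### The homogeneous model `G₂/P̄`

`P̄` is the stabilizer in `G₂` of the plane `E' = span(e₁, e₂)`, which is totally null for `H` and
satisfies `X ⌟ Y ⌟ Φ = 0` for `X, Y ∈ E'`. The tangent bundle of `G₂/P̄` is `G₂ ×_P̄ (𝔤₂/𝔭̄)`. -/

/-- The plane `E' = span(e₁, e₂)`. -/
def planeE : Submodule ℝ V7 := Submodule.span ℝ {Pi.single 0 1, Pi.single 1 1}

open Matrix in
/-- The condition for `A ∈ 𝔤₂` to lie in `𝔭̄`, the stabilizer of `E'`. -/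
def InPBar (A : Matrix (Fin 7) (Fin 7) ℝ) : Prop := ∀ u ∈ planeE, A *ᵥ u ∈ planeE

open Matrix in
/-- The condition for `A ∈ 𝔤₂` to lie in the filtration component `𝔤₂⁻¹`, whose quotient by `𝔭̄`
is the contact hyperplane of `G₂/P̄` at the base point: `A` maps `E'` to its `H`-complement. -/
def InGMinusOne (A : Matrix (Fin 7) (Fin 7) ℝ) : Prop :=
  ∀ u ∈ planeE, ∀ v ∈ planeE, Hform (A *ᵥ u) v = 0

open Matrix in
/-- The quartic form on `𝔤₂⁻¹/𝔭̄`, which is `P̄`-invariant up to scale: the determinant of the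
quadratic form `u ↦ H(Au, Au)` on `E'`. Under `𝔤₂⁻¹/𝔭̄ ≅ S³ℝ²` it is a multiple of the
discriminant of binary cubics. -/
def modelQuartic (A : Matrix (Fin 7) (Fin 7) ℝ) : ℝ :=
  let a : V7 := A *ᵥ Pi.single 0 1
  let b : V7 := A *ᵥ Pi.single 1 1
  Hform a a * Hform b b - Hform a b ^ 2

/-- The pull-back `g⁻¹ dg` of the Maurer–Cartan form along a matrix-valued map `g`, at `x` and
evaluated on `v`. -/
def maurerCartan (g : R5 → GL (Fin 7) ℝ) (x v : R5) : Matrix (Fin 7) (Fin 7) ℝ :=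
  ((g x)⁻¹).1 * Matrix.of fun i j => fderiv ℝ (fun y => (g y).1 i j) x v

/-! ### `G₂`-contact structures and flatness -/

/-- `([α], [Υ])` is a `G₂`-contact structure: near each point there is a smooth frame
`h₀, …, h₃` of `ker α` identifying it with the space `S³ℝ²` of binary cubics
`a₀ s³ + 3 a₁ s² t + 3 a₂ s t² + a₃ t³` such that, up to nonzero factors, `Υ` restricts to the
discriminant of the cubic and `dα` restricts to the (nondegenerate)
`𝔤𝔩(2, ℝ)`-invariant skew form on cubics. -/
def IsG2ContactStructure (α : OneForm) (Υ : SymTensor) : Prop :=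
  ContDiff ℝ ∞ α ∧ ContDiff ℝ ∞ (fun p : R5 × R5 => Υ p.1 p.2) ∧
  ∀ p : R5, ∃ U : Set R5, IsOpen U ∧ p ∈ U ∧ ∃ h : Fin 4 → R5 → R5,
    (∀ i, ContDiffOn ℝ ∞ (h i) U) ∧
    ∀ x ∈ U, α x ≠ 0 ∧ LinearIndependent ℝ (fun i => h i x) ∧ (∀ i, α x (h i x) = 0) ∧
      (∃ c : ℝ, c ≠ 0 ∧ ∀ a : Fin 4 → ℝ,
        Υ x (∑ i, a i • h i x) = c * (Cubic.mk (a 0) (3 * a 1) (3 * a 2) (a 3)).discr) ∧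
      (∃ c : ℝ, c ≠ 0 ∧ ∀ a b : Fin 4 → ℝ,
        dOneForm α x (∑ i, a i • h i x) (∑ i, b i • h i x)
          = c * (a 0 * b 3 - a 3 * b 0 - 3 * (a 1 * b 2 - a 2 * b 1)))

/-- The `G₂`-contact structure `([α], [Υ])` is flat, i.e. locally equivalent to the homogeneous
model `G₂/P̄` with its canonical left-invariant `G₂`-contact structure. A local equivalence is the
class `x ↦ g(x) P̄` of a smooth `G₂`-valued map `g`; in terms of `ω = g⁻¹ dg`, the conditions are
that `ω` modulo `𝔭̄` is injective on tangent vectors (so that `x ↦ g(x) P̄`, a map between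
five-dimensional manifolds, is a local diffeomorphism), that `ker α` corresponds to the contact
distribution, and that `Υ` on `ker α` corresponds to the invariant quartic up to a
nonzero factor. -/
def IsFlat (α : OneForm) (Υ : SymTensor) : Prop :=
  ∀ p : R5, ∃ U : Set R5, IsOpen U ∧ p ∈ U ∧ ∃ g : R5 → GL (Fin 7) ℝ,
    (∀ x ∈ U, g x ∈ G2Group) ∧
    (∀ i j, ContDiffOn ℝ ∞ (fun x => (g x).1 i j) U) ∧
    ∀ x ∈ U,
      (∀ v, InPBar (maurerCartan g x v) → v = 0) ∧
      (∀ v, α x v = 0 ↔ InGMinusOne (maurerCartan g x v)) ∧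
      ∃ c : ℝ, c ≠ 0 ∧ ∀ v, α x v = 0 → Υ x v = c * modelQuartic (maurerCartan g x v)

end G2Contact

end

open scoped ContDiff

noncomputable section

namespace G2Contact

attribute [local instance] LieRing.ofAssociativeRing

/-! ### The algebra of smooth functions and its derivations -/

/-! Symmetries. A contact field X is determined by its Hamiltonian f = λ₀(X). The frame `D1`, …,
`D4` of ker λ₀ together with the central field `D0` spans a Heisenberg algebra, with [`D4`, `D1`] =
`D0` and [`D2`, `D3`] = 3 `D0` as the only nonzero brackets. Symmetrized second derivatives of f
along the frame lie in S²(S³ℝ²) = S⁶ℝ² ⊕ S²ℝ², and a contact field preserves [Υ₀] exactly when the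
S⁶ part vanishes: these are the seven equations `IsSol` (`isInfinitesimalSymmetry_iff`). Commuting
derivatives closes this system: every further derivative is a constant linear combination of 1 + 4 +
4 + 4 + 1 = 14 quantities, namely f; the Dᵢ f; `D0` f and three second derivatives; the Dᵢ `D0` f;
and `D0` `D0` f, which is constant. Hence a solution is determined by 14 numbers at the origin
(`IsSol.eq_zero`). The Hamiltonians of the fourteen fields are solutions and realize every value of
these numbers (`isSol_combHam`, `jet_combHam`), so the fields span all symmetries.

Lie algebra. No bracket table is computed. The coordinates x parametrize planes in ℝ⁷, spanned by
the columns of `planeFrame`, and each combination of the fields moves these planes as a matrix of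
the stabilizer of Φ does (`realizes_comb`). This correspondence respects brackets (`Realizes.lie`),
and the matrix determines the field (`Realizes.unique`). Since `g2Matrix` parametrizes the whole
stabilizer (`g2Matrix_g2Coeff`), the span of the fields is the image of an injective Lie algebra
homomorphism from 𝔤₂; closure under brackets and the isomorphism follow together.

Geometry. The frame `D1`, …, `D4` itself identifies ker λ₀ with binary cubics. For flatness,
`planeFrame` is completed to a unipotent matrix in G₂. As this matrix preserves H, the conditions on
its Maurer–Cartan form become values of H on derivatives of the two columns, and these values are λ₀
and -Υ₀. -/

/-- The algebra `C^∞(ℝ⁵)`. -/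
def Smooth : Subalgebra ℝ (R5 → ℝ) where
  carrier := {f | ContDiff ℝ ∞ f}
  mul_mem' {f g} (hf : ContDiff ℝ ∞ f) (hg : ContDiff ℝ ∞ g) := hf.mul hg
  add_mem' {f g} (hf : ContDiff ℝ ∞ f) (hg : ContDiff ℝ ∞ g) := hf.add hg
  algebraMap_mem' c := show ContDiff ℝ ∞ (fun _ => c) from contDiff_const

namespace Smooth

instance : CoeFun Smooth (fun _ => R5 → ℝ) := ⟨fun f => f.1⟩

theorem smooth (f : Smooth) : ContDiff ℝ ∞ (f : R5 → ℝ) := f.2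

theorem diff (f : Smooth) : Differentiable ℝ (f : R5 → ℝ) :=
  (smooth f).differentiable (by simp)

@[ext] theorem ext {f g : Smooth} (h : ∀ x, f x = g x) : f = g := Subtype.ext (funext h)

@[simp] theorem add_apply (f g : Smooth) (x : R5) : (f + g) x = f x + g x := rfl
@[simp] theorem sub_apply (f g : Smooth) (x : R5) : (f - g) x = f x - g x := rfl
@[simp] theorem neg_apply (f : Smooth) (x : R5) : (-f) x = -f x := rfl
@[simp] theorem mul_apply (f g : Smooth) (x : R5) : (f * g) x = f x * g x := rfl
@[simp] theorem pow_apply (f : Smooth) (n : ℕ) (x : R5) : (f ^ n) x = f x ^ n := rfl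
@[simp] theorem smul_apply (c : ℝ) (f : Smooth) (x : R5) : (c • f) x = c * f x := rfl
@[simp] theorem zero_apply (x : R5) : (0 : Smooth) x = 0 := rfl
@[simp] theorem one_apply (x : R5) : (1 : Smooth) x = 1 := rfl
@[simp] theorem two_apply (x : R5) : (2 : Smooth) x = 2 := rfl
@[simp] theorem three_apply (x : R5) : (3 : Smooth) x = 3 := rfl
@[simp] theorem sum_apply {ι : Type*} (s : Finset ι) (f : ι → Smooth) (x : R5) :
    (∑ i ∈ s, f i) x = ∑ i ∈ s, f i x := by
  classical
  induction s using Finset.induction_on with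
  | empty => rfl
  | insert a s ha ih => rw [Finset.sum_insert ha, Finset.sum_insert ha, ← ih]; rfl

end Smooth

/-- The coordinate functions. -/
def coord (i : Fin 5) : Smooth := ⟨fun x => x i, show ContDiff ℝ ∞ _ from contDiff_apply ℝ ℝ i⟩

@[simp] theorem coord_apply (i : Fin 5) (x : R5) : coord i x = x i := rfl

/-- The components of a smooth vector field. -/
def comp (V : SmoothVF) (i : Fin 5) : Smooth :=
  ⟨fun x => (V : R5 → R5) x i, contDiff_pi.1 (contDiff_coe V) i⟩

@[simp] theorem comp_apply (V : SmoothVF) (i : Fin 5) (x : R5) :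
    comp V i x = (V : R5 → R5) x i := rfl

theorem smoothVF_ext {V W : SmoothVF} (h : ∀ i, comp V i = comp W i) : V = W := by
  ext1; funext x i
  exact congrFun (congrArg Subtype.val (h i)) x

@[simp] theorem comp_add (V W : SmoothVF) (i : Fin 5) : comp (V + W) i = comp V i + comp W i := rfl
@[simp] theorem comp_sub (V W : SmoothVF) (i : Fin 5) : comp (V - W) i = comp V i - comp W i := rfl
@[simp] theorem comp_smul (c : ℝ) (V : SmoothVF) (i : Fin 5) : comp (c • V) i = c • comp V i := rfl

/-- The derivation of `C^∞(ℝ⁵)` given by a smooth vector field. -/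
def der (V : SmoothVF) : Derivation ℝ Smooth Smooth where
  toFun f := ⟨fun x => fderiv ℝ f x ((V : R5 → R5) x),
    ((Smooth.smooth f).fderiv_right (m := ∞) (by simp)).clm_apply (contDiff_coe V)⟩
  map_add' f g := by
    ext x
    exact congrArg (fun L : R5 →L[ℝ] ℝ => L ((V : R5 → R5) x))
      (fderiv_add ((Smooth.diff f) x) ((Smooth.diff g) x))
  map_smul' c f := by
    ext x
    exact congrArg (fun L : R5 →L[ℝ] ℝ => L ((V : R5 → R5) x))
      (fderiv_const_smul ((Smooth.diff f) x) c)
  map_one_eq_zero' := by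
    ext x
    exact congrArg (fun L : R5 →L[ℝ] ℝ => L ((V : R5 → R5) x)) (fderiv_const_apply (1 : ℝ))
  leibniz' f g := by
    ext x
    exact congrArg (fun L : R5 →L[ℝ] ℝ => L ((V : R5 → R5) x))
      (fderiv_mul ((Smooth.diff f) x) ((Smooth.diff g) x))

theorem der_apply (V : SmoothVF) (f : Smooth) (x : R5) :
    der V f x = fderiv ℝ f x ((V : R5 → R5) x) := rfl

@[simp] theorem der_coord (V : SmoothVF) (i : Fin 5) : der V (coord i) = comp V i := by
  ext x
  rw [der_apply]
  have h : fderiv ℝ (coord i : R5 → ℝ) x = dx i := (dx i).fderiv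
  rw [h]; rfl

/-- The coordinate derivations `∂ᵢ`. -/
def pd (i : Fin 5) : Derivation ℝ Smooth Smooth :=
  der ⟨fun _ => Pi.single i 1, show ContDiff ℝ ∞ _ from contDiff_const⟩

theorem pd_apply (i : Fin 5) (f : Smooth) (x : R5) :
    pd i f x = fderiv ℝ f x (Pi.single i 1) := rfl

@[simp] theorem pd_coord (i j : Fin 5) : pd i (coord j) = if i = j then 1 else 0 := by
  rw [pd, der_coord]
  ext x
  by_cases h : i = j
  · subst h; simp
  · simp [h, Ne.symm h]

theorem fderiv_eq_sum (f : Smooth) (x v : R5) : fderiv ℝ f x v = ∑ i, v i * pd i f x := by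
  conv_lhs => rw [pi_eq_sum_univ' v, map_sum]
  refine Finset.sum_congr rfl fun i _ => ?_
  rw [map_smul, pd_apply, smul_eq_mul]

theorem der_eq_sum (V : SmoothVF) (f : Smooth) : der V f = ∑ i, comp V i * pd i f := by
  ext x
  rw [der_apply, fderiv_eq_sum, Smooth.sum_apply]; rfl

theorem pd_comm (i j : Fin 5) (f : Smooth) : pd i (pd j f) = pd j (pd i f) := by
  ext x
  have hs : IsSymmSndFDerivAt ℝ (f : R5 → ℝ) x :=
    (Smooth.smooth f).contDiffAt.isSymmSndFDerivAt
      (by simp only [minSmoothness_of_isRCLikeNormedField]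
          exact WithTop.coe_le_coe.2 (le_top : (2 : ℕ∞) ≤ ⊤))
  have hd : DifferentiableAt ℝ (fderiv ℝ (f : R5 → ℝ)) x :=
    (((Smooth.smooth f).fderiv_right (m := ∞) (by simp)).differentiable (by simp)) x
  have key : ∀ a b : Fin 5, pd a (pd b f) x
      = fderiv ℝ (fderiv ℝ (f : R5 → ℝ)) x (Pi.single a 1) (Pi.single b 1) := fun a b => by
    rw [pd_apply]
    have : ((pd b f : Smooth) : R5 → ℝ) = fun y => fderiv ℝ (f : R5 → ℝ) y (Pi.single b 1) := rfl
    rw [this, fderiv_clm_apply hd (by fun_prop)]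
    simp
  rw [key, key]
  exact hs _ _

theorem comp_lie (V W : SmoothVF) (i : Fin 5) :
    comp ⁅V, W⁆ i = der V (comp W i) - der W (comp V i) := by
  have h : ∀ (Y : SmoothVF) (x v : R5),
      fderiv ℝ (comp Y i : R5 → ℝ) x v = fderiv ℝ (Y : R5 → R5) x v i := fun Y x v => by
    have := fderiv_pi (𝕜 := ℝ) (φ := fun (i : Fin 5) (x : R5) => (Y : R5 → R5) x i) (x := x)
      fun i => Smooth.diff (comp Y i) x
    exact (congrArg (fun L : R5 →L[ℝ] R5 => L v i) this).symm
  ext x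
  rw [Smooth.sub_apply, der_apply, der_apply, h, h, comp_apply, coe_bracket]
  rfl

/-- The second-order terms are symmetric in V and W by `pd_comm`, so they cancel in the commutator.
-/
theorem der_lie (V W : SmoothVF) (f : Smooth) :
    der ⁅V, W⁆ f = der V (der W f) - der W (der V f) := by
  have h : ∀ A B : SmoothVF, der A (der B f)
      = ∑ i, der A (comp B i) * pd i f + ∑ i, ∑ j, comp A j * comp B i * pd j (pd i f) := by
    intro A B
    rw [der_eq_sum B f, map_sum, ← Finset.sum_add_distrib]
    refine Finset.sum_congr rfl fun i _ => ?_
    rw [Derivation.leibniz, der_eq_sum A (pd i f), smul_eq_mul, smul_eq_mul, Finset.mul_sum,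
      add_comm]
    congr 1
    · ring
    · exact Finset.sum_congr rfl fun j _ => by ring
  have hs : ∑ i, ∑ j, comp V j * comp W i * pd j (pd i f)
      = ∑ i, ∑ j, comp W j * comp V i * pd j (pd i f) := by
    rw [Finset.sum_comm]
    refine Finset.sum_congr rfl fun i _ => Finset.sum_congr rfl fun j _ => ?_
    rw [pd_comm]; ring
  rw [h, h, hs, der_eq_sum]
  simp only [comp_lie, sub_mul, Finset.sum_sub_distrib]
  ring

theorem eq_zero_of_pd_eq_zero {f : Smooth} (h : ∀ i, pd i f = 0) (h0 : f 0 = 0) : f = 0 := by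
  ext x
  rw [is_const_of_fderiv_eq_zero (𝕜 := ℝ) (Smooth.diff f) (fun y => ?_) x 0, h0]
  · rfl
  · ext v
    rw [fderiv_eq_sum]
    simp [h]

/-! ### The contact frame -/

/-- `∂₀`, which commutes with the frame `D1, …, D4` of `ker λ₀`. -/
def D0 : Derivation ℝ Smooth Smooth := pd 0
/-- The frame field `∂₁` of `ker λ₀`. -/
def D1 : Derivation ℝ Smooth Smooth := pd 1
/-- The frame field `∂₂` of `ker λ₀`. -/
def D2 : Derivation ℝ Smooth Smooth := pd 2
/-- The frame field `∂₃ + 3 x₂ ∂₀` of `ker λ₀`. -/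
def D3 : Derivation ℝ Smooth Smooth := pd 3 + ((3 : ℝ) • coord 2) • pd 0
/-- The frame field `∂₄ - x₁ ∂₀` of `ker λ₀`. -/
def D4 : Derivation ℝ Smooth Smooth := pd 4 - coord 1 • pd 0

theorem D0_eq (f : Smooth) : D0 f = pd 0 f := rfl
theorem D1_eq (f : Smooth) : D1 f = pd 1 f := rfl
theorem D2_eq (f : Smooth) : D2 f = pd 2 f := rfl
theorem D3_eq (f : Smooth) : D3 f = pd 3 f + ((3 : ℝ) • coord 2) * pd 0 f := rfl
theorem D4_eq (f : Smooth) : D4 f = pd 4 f - coord 1 * pd 0 f := rfl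

/-- The coframe λ₀, dx₁, …, dx₄ is dual to `D0`, …, `D4`. This expansion isolates the part of a
differential that is a multiple of λ₀. -/
theorem fderiv_eq_frame (f : Smooth) (x v : R5) : fderiv ℝ f x v
    = lam0 x v * D0 f x + v 1 * D1 f x + v 2 * D2 f x + v 3 * D3 f x + v 4 * D4 f x := by
  rw [fderiv_eq_sum, Fin.sum_univ_five, D0_eq, D1_eq, D2_eq, D3_eq, D4_eq]
  simp [lam0]
  ring

theorem D0_D1 (f : Smooth) : D0 (D1 f) = D1 (D0 f) := pd_comm _ _ _
theorem D0_D2 (f : Smooth) : D0 (D2 f) = D2 (D0 f) := pd_comm _ _ _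
theorem D0_D3 (f : Smooth) : D0 (D3 f) = D3 (D0 f) := by
  simp only [D3_eq, D0_eq, map_add, Derivation.leibniz, pd_comm 3 0]
  simp
theorem D0_D4 (f : Smooth) : D0 (D4 f) = D4 (D0 f) := by
  simp only [D4_eq, D0_eq, map_sub, Derivation.leibniz, pd_coord, pd_comm 4 0]
  simp
theorem D2_D1 (f : Smooth) : D2 (D1 f) = D1 (D2 f) := pd_comm _ _ _
theorem D3_D1 (f : Smooth) : D3 (D1 f) = D1 (D3 f) := by
  simp only [D3_eq, D1_eq, map_add, Derivation.leibniz, pd_comm 3 1,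
    pd_comm 1 0]
  simp
theorem D4_D1 (f : Smooth) : D4 (D1 f) = D1 (D4 f) + D0 f := by
  simp only [D4_eq, D1_eq, D0_eq, map_sub, Derivation.leibniz, pd_coord, pd_comm 4 1,
    pd_comm 1 0]
  ext x
  simp
  ring
theorem D2_D3 (f : Smooth) : D2 (D3 f) = D3 (D2 f) + (3 : ℝ) • D0 f := by
  simp only [D3_eq, D2_eq, D0_eq, map_add, Derivation.leibniz, pd_comm 3 2,
    pd_comm 2 0]
  ext x
  simp
  ring
theorem D4_D2 (f : Smooth) : D4 (D2 f) = D2 (D4 f) := by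
  simp only [D4_eq, D2_eq, map_sub, Derivation.leibniz, pd_coord, pd_comm 4 2,
    pd_comm 2 0]
  simp
theorem D4_D3 (f : Smooth) : D4 (D3 f) = D3 (D4 f) := by
  simp only [D4_eq, D3_eq, map_sub, map_add, Derivation.leibniz, pd_coord, pd_comm 4 3,
    pd_comm 3 0, pd_comm 4 0]
  ext x
  simp
  ring

/-- The contact distribution is bracket-generating: `D0` is the commutator of `D4` and `D1`, so
constancy along the frame is constancy. -/
theorem eq_zero_of_frame_eq_zero {f : Smooth} (h1 : D1 f = 0) (h2 : D2 f = 0) (h3 : D3 f = 0)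
    (h4 : D4 f = 0) (hf : f 0 = 0) : f = 0 := by
  have h0 : D0 f = 0 := by
    have h := D4_D1 f
    rw [h1, h4, map_zero, map_zero, zero_add] at h
    exact h.symm
  rw [D3_eq, ← D0_eq, h0, mul_zero, add_zero] at h3
  rw [D4_eq, ← D0_eq, h0, mul_zero, sub_zero] at h4
  refine eq_zero_of_pd_eq_zero (fun i => ?_) hf
  fin_cases i
  exacts [h0, h1, h2, h3, h4]

/-! ### The prolongation of the symmetry equations

For a contact vector field `X` and `f = λ₀(X)`, the field `X` preserves `[Υ₀]` if and only if the
second derivatives of `f` along `ker λ₀` have no component in `S⁶ℝ²`. -/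

/-- The component in `S⁶ℝ²` of the second derivatives of `f` along `ker λ₀` vanishes. -/
structure IsSol (f : Smooth) : Prop where
  r11 : D1 (D1 f) = 0
  r12 : D1 (D2 f) = 0
  r22 : D2 (D2 f) = (-2 : ℝ) • D1 (D3 f)
  r14 : D1 (D4 f) = -D3 (D2 f) - (2 : ℝ) • D0 f
  r33 : D3 (D3 f) = (-2 : ℝ) • D2 (D4 f)
  r34 : D3 (D4 f) = 0
  r44 : D4 (D4 f) = 0

namespace IsSol

variable {f g : Smooth}

/-- `D0` commutes with the frame, so all relations found for f may be reused for `D0 f`. -/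
theorem D0_sol (h : IsSol f) : IsSol (D0 f) where
  r11 := by rw [← D0_D1, ← D0_D1, h.r11, map_zero]
  r12 := by rw [← D0_D2, ← D0_D1, h.r12, map_zero]
  r22 := by rw [← D0_D2, ← D0_D2, h.r22, Derivation.map_smul, D0_D1, D0_D3]
  r14 := by rw [← D0_D4, ← D0_D1, h.r14, map_sub, map_neg, Derivation.map_smul, D0_D3, D0_D2]
  r33 := by rw [← D0_D3, ← D0_D3, h.r33, Derivation.map_smul, D0_D2, D0_D4]
  r34 := by rw [← D0_D4, ← D0_D3, h.r34, map_zero]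
  r44 := by rw [← D0_D4, ← D0_D4, h.r44, map_zero]

theorem sub (hf : IsSol f) (hg : IsSol g) : IsSol (f - g) where
  r11 := by simp only [map_sub, hf.r11, hg.r11, sub_zero]
  r12 := by simp only [map_sub, hf.r12, hg.r12, sub_zero]
  r22 := by simp only [map_sub, hf.r22, hg.r22, smul_sub]
  r14 := by simp only [map_sub, hf.r14, hg.r14]; module
  r33 := by simp only [map_sub, hf.r33, hg.r33, smul_sub]
  r34 := by simp only [map_sub, hf.r34, hg.r34, sub_zero]
  r44 := by simp only [map_sub, hf.r44, hg.r44, sub_zero]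

/-! Third derivatives. -/

/-- The letters a, b, c denote `D1 (D3 f)`, `D3 (D2 f)`, `D2 (D4 f)`, which with `D0 f` determine
all second derivatives along the frame; the digit names the field applied to them. All first
derivatives of a, b, c along the frame turn out to be multiples of some Dᵢ `D0` f. -/
theorem d1a (h : IsSol f) : D1 (D1 (D3 f)) = 0 := by
  rw [← D3_D1, ← D3_D1, h.r11, map_zero]
theorem d2a (h : IsSol f) : D2 (D1 (D3 f)) = (3 : ℝ) • D1 (D0 f) := by
  rw [D2_D1, D2_D3, map_add, Derivation.map_smul, ← D3_D1, h.r12, map_zero, zero_add]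
theorem d4a (h : IsSol f) : D4 (D1 (D3 f)) = D3 (D0 f) := by
  rw [D4_D1, D4_D3, h.r34, map_zero, zero_add, D0_D3]
theorem d1b (h : IsSol f) : D1 (D3 (D2 f)) = 0 := by
  rw [← D3_D1, h.r12, map_zero]
theorem d4b (h : IsSol f) : D4 (D3 (D2 f)) = (-3 : ℝ) • D4 (D0 f) := by
  rw [D4_D3, D4_D2]
  have e := D2_D3 (D4 f)
  rw [h.r34, map_zero, D0_D4] at e
  linear_combination (norm := module) -e
theorem d1c (h : IsSol f) : D1 (D2 (D4 f)) = -D2 (D0 f) := by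
  have e := D4_D1 (D2 f)
  rw [h.r12, map_zero, D4_D2, D0_D2] at e
  linear_combination (norm := module) -e
theorem d2b (h : IsSol f) : D2 (D3 (D2 f)) = -D2 (D0 f) := by
  have e := h.d1c
  rw [← D2_D1, h.r14, map_sub, map_neg, Derivation.map_smul] at e
  linear_combination (norm := module) -e
theorem d2c (h : IsSol f) : D2 (D2 (D4 f)) = (-2 : ℝ) • D3 (D0 f) := by
  rw [← D4_D2, ← D4_D2, h.r22, Derivation.map_smul, h.d4a]
theorem d3a (h : IsSol f) : D3 (D1 (D3 f)) = (2 : ℝ) • D2 (D0 f) := by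
  have e := D2_D3 (D2 f)
  rw [h.d2b, h.r22, Derivation.map_smul, D0_D2] at e
  linear_combination (norm := module) (1 / 2 : ℝ) • e
theorem d3c (h : IsSol f) : D3 (D2 (D4 f)) = (-3 : ℝ) • D4 (D0 f) := by
  have e := D2_D3 (D4 f)
  rw [h.r34, map_zero, D0_D4] at e
  linear_combination (norm := module) -e
theorem d4c (h : IsSol f) : D4 (D2 (D4 f)) = 0 := by
  rw [D4_D2, h.r44, map_zero]
theorem d3b (h : IsSol f) : D3 (D3 (D2 f)) = (-2 : ℝ) • D3 (D0 f) := by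
  -- Both relations contain `D3 (D2 (D3 f))`, which is eliminated between them.
  have e := D2_D3 (D3 f)
  have e' := congrArg D3 (D2_D3 f)
  rw [h.r33, Derivation.map_smul, h.d2c, D0_D3] at e
  rw [map_add, Derivation.map_smul] at e'
  linear_combination (norm := module) -e - e'

/-! Fourth derivatives. -/

/-- Evaluated through the third-derivative formulas, the commutator of `D2` and `D3` on a is -7
times `D0` a, while the bracket relation makes it 3 times `D0` a. -/
theorem d0a (h : IsSol f) : D0 (D1 (D3 f)) = 0 := by
  have e := D2_D3 (D1 (D3 f))
  have h' := h.D0_sol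
  rw [h.d3a, h.d2a, Derivation.map_smul, Derivation.map_smul, D3_D1, h'.r22] at e
  rw [D0_D1, D0_D3] at e ⊢
  linear_combination (norm := module) (-1 / 10 : ℝ) • e
theorem d0c (h : IsSol f) : D0 (D2 (D4 f)) = 0 := by
  have e := D2_D3 (D2 (D4 f))
  have h' := h.D0_sol
  rw [h.d3c, h.d2c, Derivation.map_smul, Derivation.map_smul, h'.r33] at e
  rw [D0_D2, D0_D4] at e ⊢
  linear_combination (norm := module) (-1 / 10 : ℝ) • e
-- Here the commutator of `D4` and `D1` on b involves `r14`, whose `D0` term survives; this is why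
-- `D0 (D0 f)` remains as a fourteenth free quantity.
theorem d0b (h : IsSol f) : D0 (D3 (D2 f)) = (-3 / 2 : ℝ) • D0 (D0 f) := by
  have e := D4_D1 (D3 (D2 f))
  have h' := h.D0_sol
  rw [h.d1b, h.d4b, Derivation.map_smul, map_zero, h'.r14] at e
  rw [D0_D3, D0_D2] at e ⊢
  linear_combination (norm := module) (-1 / 4 : ℝ) • e

theorem d11 (h : IsSol f) : D1 (D1 (D0 f)) = 0 := h.D0_sol.r11
theorem d12 (h : IsSol f) : D1 (D2 (D0 f)) = 0 := h.D0_sol.r12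
theorem d13 (h : IsSol f) : D1 (D3 (D0 f)) = 0 := by rw [← D0_D3, ← D0_D1, h.d0a]
theorem d14 (h : IsSol f) : D1 (D4 (D0 f)) = (-1 / 2 : ℝ) • D0 (D0 f) := by
  rw [h.D0_sol.r14, ← D0_D2, ← D0_D3, h.d0b]; module
theorem d21 (h : IsSol f) : D2 (D1 (D0 f)) = 0 := by rw [D2_D1, h.d12]
theorem d22 (h : IsSol f) : D2 (D2 (D0 f)) = 0 := by rw [h.D0_sol.r22, h.d13, smul_zero]
theorem d32 (h : IsSol f) : D3 (D2 (D0 f)) = (-3 / 2 : ℝ) • D0 (D0 f) := by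
  rw [← D0_D2, ← D0_D3, h.d0b]
theorem d23 (h : IsSol f) : D2 (D3 (D0 f)) = (3 / 2 : ℝ) • D0 (D0 f) := by
  rw [D2_D3, h.d32]; module
theorem d24 (h : IsSol f) : D2 (D4 (D0 f)) = 0 := by rw [← D0_D4, ← D0_D2, h.d0c]
theorem d31 (h : IsSol f) : D3 (D1 (D0 f)) = 0 := by rw [D3_D1, h.d13]
theorem d33 (h : IsSol f) : D3 (D3 (D0 f)) = 0 := by rw [h.D0_sol.r33, h.d24, smul_zero]
theorem d34 (h : IsSol f) : D3 (D4 (D0 f)) = 0 := h.D0_sol.r34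
theorem d41 (h : IsSol f) : D4 (D1 (D0 f)) = (1 / 2 : ℝ) • D0 (D0 f) := by
  rw [D4_D1, h.d14]; module
theorem d42 (h : IsSol f) : D4 (D2 (D0 f)) = 0 := by rw [D4_D2, h.d24]
theorem d43 (h : IsSol f) : D4 (D3 (D0 f)) = 0 := by rw [D4_D3, h.d34]
theorem d44 (h : IsSol f) : D4 (D4 (D0 f)) = 0 := h.D0_sol.r44

/-! Fifth derivatives. -/

/-- In each of the four cases a pair of frame fields with nonzero bracket is chosen so that both of
them annihilate the function Dᵢ `D0` f; their bracket, a multiple of `D0`, then annihilates it too.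
-/
theorem d100 (h : IsSol f) : D1 (D0 (D0 f)) = 0 := by
  have e := D2_D3 (D1 (D0 f))
  rw [h.d31, h.d21, map_zero, map_zero, D0_D1] at e
  linear_combination (norm := module) (-1 / 3 : ℝ) • e
theorem d200 (h : IsSol f) : D2 (D0 (D0 f)) = 0 := by
  have e := D4_D1 (D2 (D0 f))
  rw [h.d12, h.d42, map_zero, map_zero, D0_D2] at e
  linear_combination (norm := module) -e
theorem d300 (h : IsSol f) : D3 (D0 (D0 f)) = 0 := by
  have e := D4_D1 (D3 (D0 f))
  rw [h.d13, h.d43, map_zero, map_zero, D0_D3] at e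
  linear_combination (norm := module) -e
theorem d400 (h : IsSol f) : D4 (D0 (D0 f)) = 0 := by
  have e := D2_D3 (D4 (D0 f))
  rw [h.d34, h.d24, map_zero, map_zero, D0_D4] at e
  linear_combination (norm := module) (-1 / 3 : ℝ) • e

/-- A solution with vanishing weighted `4`-jet at the origin vanishes. -/
theorem eq_zero (h : IsSol f) (h0 : f 0 = 0) (h1 : D1 f 0 = 0) (h2 : D2 f 0 = 0)
    (h3 : D3 f 0 = 0) (h4 : D4 f 0 = 0) (ht : D0 f 0 = 0) (ha : D1 (D3 f) 0 = 0)
    (hb : D3 (D2 f) 0 = 0) (hc : D2 (D4 f) 0 = 0) (ht1 : D1 (D0 f) 0 = 0)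
    (ht2 : D2 (D0 f) 0 = 0) (ht3 : D3 (D0 f) 0 = 0) (ht4 : D4 (D0 f) 0 = 0)
    (hs : D0 (D0 f) 0 = 0) : f = 0 := by
  -- Descent in weight: the frame derivatives of each quantity are combinations of quantities
  -- already shown to vanish, so it is constant, and its value at the origin is zero.
  have s : D0 (D0 f) = 0 := eq_zero_of_frame_eq_zero h.d100 h.d200 h.d300 h.d400 hs
  have t1 : D1 (D0 f) = 0 := eq_zero_of_frame_eq_zero h.d11 h.d21 h.d31
    (by rw [h.d41, s, smul_zero]) ht1
  have t2 : D2 (D0 f) = 0 := eq_zero_of_frame_eq_zero h.d12 h.d22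
    (by rw [h.d32, s, smul_zero]) h.d42 ht2
  have t3 : D3 (D0 f) = 0 := eq_zero_of_frame_eq_zero h.d13
    (by rw [h.d23, s, smul_zero]) h.d33 h.d43 ht3
  have t4 : D4 (D0 f) = 0 := eq_zero_of_frame_eq_zero
    (by rw [h.d14, s, smul_zero]) h.d24 h.d34 h.d44 ht4
  have t : D0 f = 0 := eq_zero_of_frame_eq_zero t1 t2 t3 t4 ht
  have a : D1 (D3 f) = 0 := eq_zero_of_frame_eq_zero h.d1a (by rw [h.d2a, t1, smul_zero])
    (by rw [h.d3a, t2, smul_zero]) (by rw [h.d4a, t3]) ha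
  have b : D3 (D2 f) = 0 := eq_zero_of_frame_eq_zero h.d1b (by rw [h.d2b, t2, neg_zero])
    (by rw [h.d3b, t3, smul_zero]) (by rw [h.d4b, t4, smul_zero]) hb
  have c : D2 (D4 f) = 0 := eq_zero_of_frame_eq_zero (by rw [h.d1c, t2, neg_zero])
    (by rw [h.d2c, t3, smul_zero]) (by rw [h.d3c, t4, smul_zero]) h.d4c hc
  have u1 : D1 f = 0 := eq_zero_of_frame_eq_zero h.r11 (by rw [D2_D1, h.r12])
    (by rw [D3_D1, a]) (by rw [D4_D1, h.r14, b, t]; module) h1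
  have u2 : D2 f = 0 := eq_zero_of_frame_eq_zero h.r12 (by rw [h.r22, a, smul_zero]) b
    (by rw [D4_D2, c]) h2
  have u3 : D3 f = 0 := eq_zero_of_frame_eq_zero a (by rw [D2_D3, b, t]; module)
    (by rw [h.r33, c, smul_zero]) (by rw [D4_D3, h.r34]) h3
  have u4 : D4 f = 0 := eq_zero_of_frame_eq_zero (by rw [h.r14, b, t]; module) c h.r34 h.r44 h4
  exact eq_zero_of_frame_eq_zero u1 u2 u3 u4 h0

end IsSol

/-! ### Infinitesimal symmetries in terms of the contact Hamiltonian -/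

/-- The function `λ₀(X)`. -/
def hamiltonian : SmoothVF →ₗ[ℝ] Smooth where
  toFun X := comp X 0 - (3 : ℝ) • (coord 2 * comp X 3) + coord 1 * comp X 4
  map_add' X Y := by ext x; simp; ring
  map_smul' c X := by ext x; simp; ring

theorem hamiltonian_eq (X : SmoothVF) :
    hamiltonian X = comp X 0 - (3 : ℝ) • (coord 2 * comp X 3) + coord 1 * comp X 4 := rfl

/-- `X` is a contact field: it is determined by its Hamiltonian. -/
structure IsContact (X : SmoothVF) : Prop where
  c1 : comp X 1 = -D4 (hamiltonian X)
  c2 : comp X 2 = (1 / 3 : ℝ) • D3 (hamiltonian X)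
  c3 : comp X 3 = (-1 / 3 : ℝ) • D2 (hamiltonian X)
  c4 : comp X 4 = D1 (hamiltonian X)

theorem IsContact.eq_zero {X : SmoothVF} (h : IsContact X) (h0 : hamiltonian X = 0) : X = 0 := by
  have h1 := h.c1
  have h2 := h.c2
  have h3 := h.c3
  have h4 := h.c4
  have h5 := hamiltonian_eq X
  simp only [h0, map_zero, neg_zero, smul_zero] at h1 h2 h3 h4 h5
  simp only [h3, h4, mul_zero, smul_zero, sub_zero, add_zero] at h5
  refine smoothVF_ext fun i => ?_
  fin_cases i
  exacts [h5.symm, h1, h2, h3, h4]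

theorem IsContact.sub {X Y : SmoothVF} (hX : IsContact X) (hY : IsContact Y) :
    IsContact (X - Y) where
  c1 := by rw [comp_sub, hX.c1, hY.c1, map_sub, map_sub]; module
  c2 := by rw [comp_sub, hX.c2, hY.c2, map_sub, map_sub]; module
  c3 := by rw [comp_sub, hX.c3, hY.c3, map_sub, map_sub]; module
  c4 := by rw [comp_sub, hX.c4, hY.c4, map_sub, map_sub]

/-! ### Lie derivatives of λ₀ and Υ₀ -/

theorem fderiv_vf_apply (X : SmoothVF) (x v : R5) (j : Fin 5) :
    fderiv ℝ (X : R5 → R5) x v j = fderiv ℝ (comp X j : R5 → ℝ) x v := by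
  have := fderiv_pi (𝕜 := ℝ) (φ := fun (i : Fin 5) (x : R5) => (X : R5 → R5) x i) (x := x)
    fun i => Smooth.diff (comp X i) x
  exact congrArg (fun L : R5 →L[ℝ] R5 => L v j) this

theorem lam0_apply (x v : R5) : lam0 x v = v 0 - 3 * x 2 * v 3 + x 1 * v 4 := by
  simp [lam0]

theorem fderiv_lam0_apply (x u w : R5) :
    fderiv ℝ (fun y => lam0 y u) x w = -3 * w 2 * u 3 + w 1 * u 4 := by
  have : (fun y => lam0 y u) = (((u 0) • (1 : Smooth) - (3 * u 3) • coord 2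
      + (u 4) • coord 1 : Smooth) : R5 → ℝ) := by
    funext y
    simp [lam0]
    ring
  rw [this, fderiv_eq_sum, Fin.sum_univ_five]
  simp
  ring

/-- Cartan's formula L_X λ₀ = df + dλ₀(X, ·) with f = λ₀(X), expanded in the coframe λ₀, dx₁, …,
dx₄. The contact condition is the vanishing of the last four coefficients. -/
theorem lieDeriv_lam0 (X : SmoothVF) (x u : R5) :
    lieDeriv X (fun y w => lam0 y w) x u = lam0 x u * D0 (hamiltonian X) x
      + u 1 * (D1 (hamiltonian X) x - comp X 4 x) + u 2 * (D2 (hamiltonian X) x + 3 * comp X 3 x)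
      + u 3 * (D3 (hamiltonian X) x - 3 * comp X 2 x)
      + u 4 * (D4 (hamiltonian X) x + comp X 1 x) := by
  have e := fderiv_eq_frame (hamiltonian X) x u
  have e1 : fderiv ℝ (fun y => lam0 y u) x ((X : R5 → R5) x)
      = -3 * comp X 2 x * u 3 + comp X 1 x * u 4 := fderiv_lam0_apply x u _
  have e2 : fderiv ℝ (hamiltonian X : R5 → ℝ) x u = fderiv ℝ (comp X 0 : R5 → ℝ) x u
      - 3 * (x 2 * fderiv ℝ (comp X 3 : R5 → ℝ) x u + u 2 * comp X 3 x)
      + (x 1 * fderiv ℝ (comp X 4 : R5 → ℝ) x u + u 1 * comp X 4 x) := by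
    simp only [fderiv_eq_sum, Fin.sum_univ_five, hamiltonian_eq, map_sub, map_add,
      Derivation.map_smul, Derivation.leibniz, pd_coord]
    simp
    ring
  have e3 : fderiv ℝ (fun w => lam0 x w) u (fderiv ℝ (X : R5 → R5) x u)
      = lam0 x (fderiv ℝ (X : R5 → R5) x u) := by
    rw [(lam0 x).fderiv]
  rw [lieDeriv, e1, e3, lam0_apply x (fderiv ℝ (X : R5 → R5) x u)]
  simp only [fderiv_vf_apply]
  linear_combination e - e2

theorem isContact_iff (X : SmoothVF) : IsContact X ↔
    ∀ x u v, lieDeriv X (fun y w => lam0 y w) x u * lam0 x v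
      - lieDeriv X (fun y w => lam0 y w) x v * lam0 x u = 0 := by
  constructor
  · intro h x u v
    rw [lieDeriv_lam0, lieDeriv_lam0, h.c1, h.c2, h.c3, h.c4]
    simp
    ring
  · intro h
    have key : ∀ x u, lam0 x u = 0 → lieDeriv X (fun y w => lam0 y w) x u = 0 := fun x u hu => by
      -- λ₀ takes the value 1 on ∂₀, so this choice of second vector isolates the Lie derivative on
      -- u.
      have := h x u (Pi.single 0 1)
      rw [hu] at this
      simpa [lam0] using this
    simp only [lieDeriv_lam0] at key
    -- The test vectors are the values of `D4`, `D3`, `D2`, `D1` at x.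
    constructor
    · ext x
      have := key x ![-x 1, 0, 0, 0, 1] (by simp [lam0])
      simp [lam0] at this
      simp
      linarith
    · ext x
      have := key x ![3 * x 2, 0, 0, 1, 0] (by simp [lam0])
      simp [lam0] at this
      simp
      linarith
    · ext x
      have := key x ![0, 0, 1, 0, 0] (by simp [lam0])
      simp [lam0] at this
      simp
      linarith
    · ext x
      have := key x ![0, 1, 0, 0, 0] (by simp [lam0])
      simp [lam0] at this
      simp
      linarith

/-- The quartic `Υ₀` as a function on `ℝ⁵`. -/
def quartic : Smooth :=
  (-3 : ℝ) • (coord 2 ^ 2 * coord 3 ^ 2) + (4 : ℝ) • (coord 1 * coord 3 ^ 3)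
    + (4 : ℝ) • (coord 2 ^ 3 * coord 4) - (6 : ℝ) • (coord 1 * coord 2 * coord 3 * coord 4)
    + coord 1 ^ 2 * coord 4 ^ 2

theorem fderiv_ups0 (x v w : R5) : fderiv ℝ (ups0 x) v w =
    (4 * v 3 ^ 3 - 6 * v 2 * v 3 * v 4 + 2 * v 1 * v 4 ^ 2) * w 1
      + (-6 * v 2 * v 3 ^ 2 + 12 * v 2 ^ 2 * v 4 - 6 * v 1 * v 3 * v 4) * w 2
      + (-6 * v 2 ^ 2 * v 3 + 12 * v 1 * v 3 ^ 2 - 6 * v 1 * v 2 * v 4) * w 3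
      + (4 * v 2 ^ 3 - 6 * v 1 * v 2 * v 3 + 2 * v 1 ^ 2 * v 4) * w 4 := by
  have : ups0 x = (quartic : R5 → ℝ) := by
    funext y
    simp [ups0, quartic]
    ring
  rw [this, fderiv_eq_sum]
  simp only [Fin.sum_univ_five, quartic, map_sub, map_add, Derivation.map_smul,
    Derivation.leibniz, Derivation.leibniz_pow, pd_coord]
  simp
  ring

/-- Υ₀ has constant coefficients, so only the term differentiating X survives. -/
theorem lieDeriv_ups0 (X : SmoothVF) (x v : R5) : lieDeriv X ups0 x v =
    (4 * v 3 ^ 3 - 6 * v 2 * v 3 * v 4 + 2 * v 1 * v 4 ^ 2) * fderiv ℝ (comp X 1 : R5 → ℝ) x v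
      + (-6 * v 2 * v 3 ^ 2 + 12 * v 2 ^ 2 * v 4 - 6 * v 1 * v 3 * v 4)
        * fderiv ℝ (comp X 2 : R5 → ℝ) x v
      + (-6 * v 2 ^ 2 * v 3 + 12 * v 1 * v 3 ^ 2 - 6 * v 1 * v 2 * v 4)
        * fderiv ℝ (comp X 3 : R5 → ℝ) x v
      + (4 * v 2 ^ 3 - 6 * v 1 * v 2 * v 3 + 2 * v 1 ^ 2 * v 4)
        * fderiv ℝ (comp X 4 : R5 → ℝ) x v := by
  have : fderiv ℝ (fun y => ups0 y v) x = 0 := fderiv_const_apply (ups0 x v)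
  rw [lieDeriv, this, fderiv_ups0]
  simp only [fderiv_vf_apply]
  simp

/-- A linear map preserving the discriminant of binary cubics up to scale satisfies the linear
equations of the conformal stabilizer. -/
theorem stabilizer_equations {A11 A12 A13 A14 A21 A22 A23 A24 A31 A32 A33 A34 A41 A42 A43 A44 φ : ℝ}
    (h : ∀ a b c d : ℝ,
      (4 * c ^ 3 - 6 * b * c * d + 2 * a * d ^ 2) * (a * A11 + b * A21 + c * A31 + d * A41)
      + (-6 * b * c ^ 2 + 12 * b ^ 2 * d - 6 * a * c * d)
        * (a * A12 + b * A22 + c * A32 + d * A42)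
      + (-6 * b ^ 2 * c + 12 * a * c ^ 2 - 6 * a * b * d)
        * (a * A13 + b * A23 + c * A33 + d * A43)
      + (4 * b ^ 3 - 6 * a * b * c + 2 * a ^ 2 * d) * (a * A14 + b * A24 + c * A34 + d * A44)
      = φ * (-3 * b ^ 2 * c ^ 2 + 4 * a * c ^ 3 + 4 * b ^ 3 * d - 6 * a * b * c * d
        + a ^ 2 * d ^ 2)) :
    A14 = 0 ∧ A41 = 0 ∧ A31 = 0 ∧ A24 = 0 ∧ 2 * A21 = 3 * A32 ∧ 3 * A23 = 2 * A34 ∧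
      2 * (A22 + A33) = φ ∧ A11 + 3 * A33 = φ := by
  -- Both sides are quartic forms in (a, b, c, d), and ten evaluations isolate the coefficients
  -- needed. The full stabilizer satisfies further equations; for contact fields these eight are
  -- enough.
  have h1 := h 1 0 0 1
  have h2 := h 1 0 0 (-1)
  have h3 := h 2 0 0 1
  have h4 := h 0 1 0 0
  have h5 := h 0 0 1 0
  have h6 := h 0 1 1 0
  have h7 := h 0 1 (-1) 0
  have h8 := h 0 2 1 0
  have h9 := h 1 0 1 0
  have h10 := h 1 0 (-1) 0
  norm_num at h1 h2 h3 h4 h5 h6 h7 h8 h9 h10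
  refine ⟨?_, ?_, ?_, ?_, ?_, ?_, ?_, ?_⟩ <;> linarith

/-- Symmetric tensors of rank `3` with smooth components. -/
def IsCubic (F : SymTensor) : Prop :=
  ∃ τ : Fin 5 → Fin 5 → Fin 5 → R5 → ℝ, (∀ i j k, ContDiff ℝ ∞ (τ i j k)) ∧
    ∀ x v, F x v = ∑ i, ∑ j, ∑ k, τ i j k x * (v i * v j * v k)

theorem IsCubic.add {F G : SymTensor} (hF : IsCubic F) (hG : IsCubic G) :
    IsCubic fun x v => F x v + G x v := by
  obtain ⟨σ, hσ, hF⟩ := hF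
  obtain ⟨τ, hτ, hG⟩ := hG
  refine ⟨fun i j k x => σ i j k x + τ i j k x, fun i j k => (hσ i j k).add (hτ i j k), ?_⟩
  intro x v
  simp only [hF, hG, add_mul, Finset.sum_add_distrib]

theorem IsCubic.monomial (f : Smooth) (r : ℝ) (a b c : Fin 5) :
    IsCubic fun x v => r * f x * (v a * v b * v c) := by
  refine ⟨fun i j k x => if i = a then if j = b then if k = c then r * f x else 0 else 0 else 0,
    fun i j k => ?_, fun x v => ?_⟩
  · beta_reduce
    split_ifs
    exacts [contDiff_const.mul (Smooth.smooth f), contDiff_const, contDiff_const, contDiff_const]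
  · rw [Finset.sum_eq_single a, Finset.sum_eq_single b, Finset.sum_eq_single c]
    · simp
    all_goals simp +contextual

theorem isCubic_polar (f1 f2 f3 f4 : Smooth) : IsCubic fun x v =>
    (4 * v 3 ^ 3 - 6 * v 2 * v 3 * v 4 + 2 * v 1 * v 4 ^ 2) * f1 x
      + (-6 * v 2 * v 3 ^ 2 + 12 * v 2 ^ 2 * v 4 - 6 * v 1 * v 3 * v 4) * f2 x
      + (-6 * v 2 ^ 2 * v 3 + 12 * v 1 * v 3 ^ 2 - 6 * v 1 * v 2 * v 4) * f3 x
      + (4 * v 2 ^ 3 - 6 * v 1 * v 2 * v 3 + 2 * v 1 ^ 2 * v 4) * f4 x := by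
  have h := (((IsCubic.monomial f1 4 3 3 3).add (IsCubic.monomial f1 (-6) 2 3 4)).add
    (IsCubic.monomial f1 2 1 4 4)).add
    ((((IsCubic.monomial f2 (-6) 2 3 3).add (IsCubic.monomial f2 12 2 2 4)).add
    (IsCubic.monomial f2 (-6) 1 3 4)).add
    ((((IsCubic.monomial f3 (-6) 2 2 3).add (IsCubic.monomial f3 12 1 3 3)).add
    (IsCubic.monomial f3 (-6) 1 2 4)).add
    (((IsCubic.monomial f4 4 2 2 2).add (IsCubic.monomial f4 (-6) 1 2 3)).add
    (IsCubic.monomial f4 2 1 1 4))))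
  convert h using 3
  ring

theorem isInfinitesimalSymmetry_iff (X : SmoothVF) :
    IsInfinitesimalSymmetry lam0 ups0 X ↔ IsContact X ∧ IsSol (hamiltonian X) := by
  rw [IsInfinitesimalSymmetry, ← isContact_iff]
  refine and_congr_right fun hX => ?_
  set f := hamiltonian X with hf
  constructor
  · rintro ⟨φ, τ, -, -, h⟩
    have key := fun x => stabilizer_equations (φ := φ x)
      (A11 := D1 (comp X 1) x) (A12 := D1 (comp X 2) x) (A13 := D1 (comp X 3) x)
      (A14 := D1 (comp X 4) x) (A21 := D2 (comp X 1) x) (A22 := D2 (comp X 2) x)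
      (A23 := D2 (comp X 3) x) (A24 := D2 (comp X 4) x) (A31 := D3 (comp X 1) x)
      (A32 := D3 (comp X 2) x) (A33 := D3 (comp X 3) x) (A34 := D3 (comp X 4) x)
      (A41 := D4 (comp X 1) x) (A42 := D4 (comp X 2) x) (A43 := D4 (comp X 3) x)
      (A44 := D4 (comp X 4) x) fun a b c d => by
        -- This vector is a `D1` + b `D2` + c `D3` + d `D4` at x; the τ term vanishes on it.
        have e := h x ![3 * x 2 * c - x 1 * d, a, b, c, d]
        have hl : lam0 x ![3 * x 2 * c - x 1 * d, a, b, c, d] = 0 := by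
          simp [lam0_apply]
        rw [lieDeriv_ups0] at e
        simp only [fderiv_eq_frame, hl, zero_mul, zero_add, add_zero] at e
        simpa [ups0] using e
    rw [hX.c1, hX.c2, hX.c3, hX.c4] at key
    simp only [map_neg, Derivation.map_smul, Smooth.neg_apply, Smooth.smul_apply, ← hf, D2_D3,
      D2_D1, D3_D1, Smooth.add_apply] at key
    constructor <;> ext x <;>
    · obtain ⟨k1, k2, k3, k4, k5, k6, k7, k8⟩ := key x
      simp
      linarith
  · intro h
    -- In the Lie derivative of Υ₀ the λ₀ part of each differential contributes λ₀ times the polar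
    -- of Υ₀ in the direction `D0` X, which is the tensor τ. The conformal factor 2 `D0` f is the φ
    -- forced by 2(A22 + A33) = φ, as A22 + A33 = `D0` f for a contact field.
    obtain ⟨τ, hτ, e⟩ := isCubic_polar (D0 (comp X 1)) (D0 (comp X 2)) (D0 (comp X 3))
      (D0 (comp X 4))
    refine ⟨(2 : ℝ) • D0 f, τ, Smooth.smooth ((2 : ℝ) • D0 f), hτ, fun x v => ?_⟩
    rw [← e, lieDeriv_ups0]
    simp only [fderiv_eq_frame, ups0]
    rw [hX.c1, hX.c2, hX.c3, hX.c4]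
    simp only [map_neg, Derivation.map_smul, ← hf, D4_D3, D4_D1, D4_D2, D2_D3, D2_D1, D3_D1, h.r11,
      h.r12, h.r22, h.r14, h.r33, h.r34, h.r44]
    simp
    ring

/-! ### The linear combinations of the fourteen fields -/

/-- The coordinate `y₀ = x₀ - 3 x₂ x₃`. -/
def heightY : Smooth := coord 0 - (3 : ℝ) • (coord 2 * coord 3)

/-- The linear combinations of the fourteen fields. -/
def comb (c : Fin 14 → ℝ) : SmoothVF := ∑ k, c k • field k

theorem mem_span_field_iff (X : SmoothVF) :
    X ∈ Submodule.span ℝ (Set.range field) ↔ ∃ c, comb c = X :=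
  Submodule.mem_span_range_iff_exists_fun ℝ

theorem comp_comb (c : Fin 14 → ℝ) (i : Fin 5) (x : R5) :
    comp (comb c) i x = ∑ k, c k * fieldFun k x i := by
  rw [comp_apply, comb]
  simp [field, Finset.sum_apply]

/-- The Hamiltonian of a linear combination of the fourteen fields. -/
def combHam (c : Fin 14 → ℝ) : Smooth :=
    c 0 • (heightY ^ 2) + c 0 • (heightY * coord 1 * coord 4)
    + (3 * c 0) • (heightY * coord 2 * coord 3)
    + (3 * c 0) • (coord 1 * coord 2 * coord 3 * coord 4) + (-c 0) • (coord 1 * coord 3 ^ 3)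
    + (-c 0) • (coord 2 ^ 3 * coord 4) + (3 * c 0) • (coord 2 ^ 2 * coord 3 ^ 2)
    + (-c 1) • (heightY * coord 4) + (-c 1) • (coord 1 * coord 4 ^ 2) + (-c 1) • (coord 3 ^ 3)
    + (1/2 * c 2) • (heightY * coord 3) + (1/2 * c 2) • (coord 1 * coord 3 * coord 4)
    + ((-1/2) * c 2) • (coord 2 ^ 2 * coord 4) + c 2 • (coord 2 * coord 3 ^ 2)
    + (-c 3) • (coord 2 * coord 4) + c 3 • (coord 3 ^ 2) + (-c 4) • coord 4
    + c 5 • (heightY * coord 2) + c 5 • (coord 1 * coord 3 ^ 2) + c 5 • (coord 2 ^ 2 * coord 3)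
    + c 6 • heightY+ (2 * c 6) • (coord 2 * coord 3) + (1/2 * c 7) • (heightY * coord 1)
    + (3/2 * c 7) • (coord 1 * coord 2 * coord 3) + ((-1/2) * c 7) • (coord 2 ^ 3)
    + c 8 • (coord 1 * coord 3) + (-c 8) • (coord 2 ^ 2) + c 9 • coord 1 + c 10 • heightY
    + c 10 • (coord 1 * coord 4) + c 10 • (coord 2 * coord 3) + ((-3) * c 11) • coord 2
    + (3 * c 12) • coord 3 + c 13 • 1

/-- The component `x1` of a linear combination of the fourteen fields. -/
def comb1 (c : Fin 14 → ℝ) : Smooth :=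
    c 0 • (heightY * coord 1) + c 0 • (coord 1 ^ 2 * coord 4) + c 0 • (coord 2 ^ 3) + c 1 • heightY
    + c 1 • (coord 1 * coord 4) + (1/2 * c 2) • (coord 2 ^ 2) + c 3 • coord 2 + c 4 • 1
    + c 5 • (coord 1 * coord 2) + c 6 • coord 1 + (1/2 * c 7) • (coord 1 ^ 2)

/-- The component `x2` of a linear combination of the fourteen fields. -/
def comb2 (c : Fin 14 → ℝ) : Smooth :=
    c 0 • (heightY * coord 2) + c 0 • (coord 1 * coord 2 * coord 4)
    + (-c 0) • (coord 1 * coord 3 ^ 2) + (2 * c 0) • (coord 2 ^ 2 * coord 3)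
    + (-c 1) • (coord 3 ^ 2) + (1/6 * c 2) • heightY+ (1/6 * c 2) • (coord 1 * coord 4)
    + (2/3 * c 2) • (coord 2 * coord 3) + (2/3 * c 3) • coord 3
    + (2/3 * c 5) • (coord 1 * coord 3) + (1/3 * c 5) • (coord 2 ^ 2) + (2/3 * c 6) • coord 2
    + (1/2 * c 7) • (coord 1 * coord 2) + (1/3 * c 8) • coord 1 + (1/3 * c 10) • coord 2
    + c 12 • 1

/-- The component `x3` of a linear combination of the fourteen fields. -/
def comb3 (c : Fin 14 → ℝ) : Smooth :=
    c 0 • (heightY * coord 3) + c 0 • (coord 2 ^ 2 * coord 4) + c 0 • (coord 2 * coord 3 ^ 2)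
    + (-c 1) • (coord 3 * coord 4) + (1/3 * c 2) • (coord 2 * coord 4)
    + (1/6 * c 2) • (coord 3 ^ 2) + (1/3 * c 3) • coord 4 + ((-1/3) * c 5) • heightY
    + (1/3 * c 5) • (coord 2 * coord 3) + (1/3 * c 6) • coord 3 + (1/2 * c 7) • (coord 2 ^ 2)
    + (2/3 * c 8) • coord 2 + (2/3 * c 10) • coord 3 + c 11 • 1

/-- The component `x4` of a linear combination of the fourteen fields. -/
def comb4 (c : Fin 14 → ℝ) : Smooth :=
    c 0 • (heightY * coord 4) + (3 * c 0) • (coord 2 * coord 3 * coord 4) + (-c 0) • (coord 3 ^ 3)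
    + (-c 1) • (coord 4 ^ 2) + (1/2 * c 2) • (coord 3 * coord 4) + c 5 • (coord 3 ^ 2)
    + (1/2 * c 7) • heightY+ (3/2 * c 7) • (coord 2 * coord 3) + c 8 • coord 3 + c 9 • 1
    + c 10 • coord 4

theorem hamiltonian_comb (c : Fin 14 → ℝ) : hamiltonian (comb c) = combHam c := by
  ext x
  simp only [hamiltonian_eq, Smooth.add_apply, Smooth.sub_apply, Smooth.smul_apply,
    Smooth.mul_apply, comp_comb, coord_apply]
  simp [combHam, heightY, fieldFun, coeff, partialY, Fin.sum_univ_succ]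
  ring

theorem comp_comb_one (c : Fin 14 → ℝ) : comp (comb c) 1 = comb1 c := by
  ext x
  rw [comp_comb]
  simp [comb1, heightY, fieldFun, coeff, partialY, Fin.sum_univ_succ]
  ring

theorem comp_comb_two (c : Fin 14 → ℝ) : comp (comb c) 2 = comb2 c := by
  ext x
  rw [comp_comb]
  simp [comb2, heightY, fieldFun, coeff, partialY, Fin.sum_univ_succ]
  ring

theorem comp_comb_three (c : Fin 14 → ℝ) : comp (comb c) 3 = comb3 c := by
  ext x
  rw [comp_comb]
  simp [comb3, heightY, fieldFun, coeff, partialY, Fin.sum_univ_succ]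
  ring

theorem comp_comb_four (c : Fin 14 → ℝ) : comp (comb c) 4 = comb4 c := by
  ext x
  rw [comp_comb]
  simp [comb4, heightY, fieldFun, coeff, partialY, Fin.sum_univ_succ]
  ring

/-! ### Frame derivatives of the fourteen Hamiltonians -/

theorem D0_coord (j : Fin 5) : D0 (coord j) = if 0 = j then 1 else 0 := pd_coord 0 j
theorem D1_coord (j : Fin 5) : D1 (coord j) = if 1 = j then 1 else 0 := pd_coord 1 j
theorem D2_coord (j : Fin 5) : D2 (coord j) = if 2 = j then 1 else 0 := pd_coord 2 j
theorem D3_coord (j : Fin 5) : D3 (coord j)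
    = (if 3 = j then 1 else 0) + ((3 : ℝ) • coord 2) * if 0 = j then 1 else 0 := by
  rw [D3_eq, pd_coord, pd_coord]
theorem D4_coord (j : Fin 5) : D4 (coord j)
    = (if 4 = j then 1 else 0) - coord 1 * if 0 = j then 1 else 0 := by
  rw [D4_eq, pd_coord, pd_coord]

theorem D0_y : D0 heightY = 1 := by
  simp [heightY, D0_coord]
theorem D1_y : D1 heightY = 0 := by
  simp [heightY, D1_coord]
theorem D2_y : D2 heightY = (-3 : ℝ) • coord 3 := by
  simp [heightY, D2_coord]
theorem D3_y : D3 heightY = 0 := by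
  simp [heightY, D3_coord]
theorem D4_y : D4 heightY = -coord 1 := by
  simp [heightY, D4_coord]

@[simp] theorem y_zero : heightY 0 = 0 := by simp [heightY]

/-- The four first derivatives in closed form give the contact condition at once, and reduce each
second derivative to a single derivative of an explicit polynomial. -/
theorem D1_combHam (c : Fin 14 → ℝ) : D1 (combHam c) = comb4 c := by
  simp only [combHam, comb4, map_add, Derivation.map_smul, Derivation.leibniz,
    Derivation.leibniz_pow, Derivation.map_one_eq_zero, D1_coord, D1_y]
  ext x
  simp
  ring

theorem D2_combHam (c : Fin 14 → ℝ) : D2 (combHam c) = (-3 : ℝ) • comb3 c := by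
  simp only [combHam, comb3, map_add, Derivation.map_smul, Derivation.leibniz,
    Derivation.leibniz_pow, Derivation.map_one_eq_zero, D2_coord, D2_y]
  ext x
  simp
  ring

theorem D3_combHam (c : Fin 14 → ℝ) : D3 (combHam c) = (3 : ℝ) • comb2 c := by
  simp only [combHam, comb2, map_add, Derivation.map_smul, Derivation.leibniz,
    Derivation.leibniz_pow, Derivation.map_one_eq_zero, D3_coord, D3_y]
  ext x
  simp
  ring

theorem D4_combHam (c : Fin 14 → ℝ) : D4 (combHam c) = -comb1 c := by
  simp only [combHam, comb1, map_add, Derivation.map_smul, Derivation.leibniz,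
    Derivation.leibniz_pow, Derivation.map_one_eq_zero, D4_coord, D4_y]
  ext x
  simp
  ring

theorem isContact_comb (c : Fin 14 → ℝ) : IsContact (comb c) where
  c1 := by rw [comp_comb_one, hamiltonian_comb, D4_combHam, neg_neg]
  c2 := by rw [comp_comb_two, hamiltonian_comb, D3_combHam]; module
  c3 := by rw [comp_comb_three, hamiltonian_comb, D2_combHam]; module
  c4 := by rw [comp_comb_four, hamiltonian_comb, D1_combHam]

theorem isSol_combHam (c : Fin 14 → ℝ) : IsSol (combHam c) where
  r11 := by
    rw [D1_combHam]
    simp only [comb4, map_add, Derivation.map_smul, Derivation.leibniz,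
      Derivation.leibniz_pow, Derivation.map_one_eq_zero, D1_coord, D1_y]
    simp
  r12 := by
    rw [D2_combHam]
    simp only [comb3, map_add, Derivation.map_smul, Derivation.leibniz,
      Derivation.leibniz_pow, Derivation.map_one_eq_zero, D1_coord, D1_y]
    simp
  r22 := by
    rw [D2_combHam, D3_combHam]
    simp only [comb2, comb3, map_add, Derivation.map_smul, Derivation.leibniz,
      Derivation.leibniz_pow, Derivation.map_one_eq_zero, D1_coord, D1_y, D2_coord, D2_y]
    ext x
    simp
    ring
  r14 := by
    rw [D4_combHam, D2_combHam]
    simp only [combHam, comb1, comb3, map_add, map_neg, Derivation.map_smul, Derivation.leibniz,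
      Derivation.leibniz_pow, Derivation.map_one_eq_zero, D1_coord, D1_y, D3_coord, D3_y, D0_coord,
      D0_y]
    ext x
    simp
    ring
  r33 := by
    rw [D4_combHam, D3_combHam]
    simp only [comb1, comb2, map_add, map_neg, Derivation.map_smul, Derivation.leibniz,
      Derivation.leibniz_pow, Derivation.map_one_eq_zero, D2_coord, D2_y, D3_coord, D3_y]
    ext x
    simp
    ring
  r34 := by
    rw [D4_combHam]
    simp only [comb1, map_add, map_neg, Derivation.map_smul, Derivation.leibniz,
      Derivation.leibniz_pow, Derivation.map_one_eq_zero, D3_coord, D3_y]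
    simp
  r44 := by
    rw [D4_combHam]
    simp only [comb1, map_add, map_neg, Derivation.map_smul, Derivation.leibniz,
      Derivation.leibniz_pow, Derivation.map_one_eq_zero, D4_coord, D4_y]
    ext x
    simp
    ring

/-- The weighted `4`-jet of a function at the origin, as the coefficients of the symmetry with
this jet. -/
def jet (f : Smooth) : Fin 14 → ℝ :=
  ![1 / 2 * D0 (D0 f) 0, -D4 (D0 f) 0, 2 * D3 (D0 f) 0, -D2 (D4 f) 0, -D4 f 0, D2 (D0 f) 0,
    2 * D0 f 0 + D3 (D2 f) 0, 2 * D1 (D0 f) 0, D1 (D3 f) 0, D1 f 0, -D0 f 0 - D3 (D2 f) 0,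
    -1 / 3 * D2 f 0, 1 / 3 * D3 f 0, f 0]

theorem IsSol.eq_zero_of_jet {f : Smooth} (h : IsSol f) (hj : jet f = 0) : f = 0 := by
  have e : ∀ i, jet f i = 0 := fun i => congrFun hj i
  have e0 := e 0
  have e1 := e 1
  have e2 := e 2
  have e3 := e 3
  have e4 := e 4
  have e5 := e 5
  have e6 := e 6
  have e7 := e 7
  have e8 := e 8
  have e9 := e 9
  have e10 := e 10
  have e11 := e 11
  have e12 := e 12
  have e13 := e 13
  simp only [jet, Matrix.cons_val] at e0 e1 e2 e3 e4 e5 e6 e7 e8 e9 e10 e11 e12 e13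
  -- All entries but two are multiples of single jet coordinates; the sum of entries 6 and 10 is `D0
  -- f 0`, which then gives `D3 (D2 f) 0`.
  apply h.eq_zero <;> linarith

theorem jet_sub (f g : Smooth) : jet (f - g) = jet f - jet g := by
  ext i
  fin_cases i <;> simp [jet] <;> ring

set_option maxHeartbeats 1000000 in
theorem jet_combHam (c : Fin 14 → ℝ) : jet (combHam c) = c := by
  have e00 : D0 (D0 (combHam c)) 0 = 2 * c 0 := by
    simp only [combHam, map_add, Derivation.map_smul, Derivation.leibniz, Derivation.leibniz_pow,
      Derivation.map_one_eq_zero, D0_coord, D0_y]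
    simp [D0_coord, D0_y]
    ring
  have ha : D1 (D3 (combHam c)) 0 = c 8 := by
    rw [D3_combHam]
    simp only [comb2, map_add, Derivation.map_smul, Derivation.leibniz, Derivation.leibniz_pow,
      Derivation.map_one_eq_zero, D1_coord, D1_y]
    simp
  have hb : D3 (D2 (combHam c)) 0 = -c 6 - 2 * c 10 := by
    rw [D2_combHam]
    simp only [comb3, map_add, Derivation.map_smul, Derivation.leibniz, Derivation.leibniz_pow,
      Derivation.map_one_eq_zero, D3_coord, D3_y]
    simp
    ring
  have hc : D2 (D4 (combHam c)) 0 = -c 3 := by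
    rw [D4_combHam]
    simp only [comb1, map_add, map_neg, Derivation.map_smul, Derivation.leibniz,
      Derivation.leibniz_pow, Derivation.map_one_eq_zero, D2_coord, D2_y]
    simp
  have e0 : D0 (combHam c) 0 = c 6 + c 10 := by
    simp only [combHam, map_add, Derivation.map_smul, Derivation.leibniz, Derivation.leibniz_pow,
      Derivation.map_one_eq_zero, D0_coord, D0_y]
    simp
  have e1 : D1 (D0 (combHam c)) 0 = 1 / 2 * c 7 := by
    -- Moving the central `D0` outside allows the closed form of the first derivative to be used.
    rw [← D0_D1, D1_combHam]
    simp only [comb4, map_add, Derivation.map_smul, Derivation.leibniz, Derivation.leibniz_pow,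
      Derivation.map_one_eq_zero, D0_coord, D0_y]
    simp
  have e2 : D2 (D0 (combHam c)) 0 = c 5 := by
    rw [← D0_D2, D2_combHam]
    simp only [comb3, map_add, Derivation.map_smul, Derivation.leibniz, Derivation.leibniz_pow,
      Derivation.map_one_eq_zero, D0_coord, D0_y]
    simp
    ring
  have e3 : D3 (D0 (combHam c)) 0 = 1 / 2 * c 2 := by
    rw [← D0_D3, D3_combHam]
    simp only [comb2, map_add, Derivation.map_smul, Derivation.leibniz, Derivation.leibniz_pow,
      Derivation.map_one_eq_zero, D0_coord, D0_y]
    simp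
    ring
  have e4 : D4 (D0 (combHam c)) 0 = -c 1 := by
    rw [← D0_D4, D4_combHam]
    simp only [comb1, map_add, map_neg, Derivation.map_smul, Derivation.leibniz,
      Derivation.leibniz_pow, Derivation.map_one_eq_zero, D0_coord, D0_y]
    simp
  have f1 : D1 (combHam c) 0 = c 9 := by
    rw [D1_combHam]; simp [comb4]
  have f2 : D2 (combHam c) 0 = -3 * c 11 := by
    rw [D2_combHam]; simp [comb3]
  have f3 : D3 (combHam c) 0 = 3 * c 12 := by
    rw [D3_combHam]; simp [comb2]
  have f4 : D4 (combHam c) 0 = -c 4 := by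
    rw [D4_combHam]; simp [comb1]
  have f0 : combHam c 0 = c 13 := by simp [combHam]
  ext i
  rw [jet, e00, ha, hb, hc, e0, e1, e2, e3, e4, f0, f1, f2, f3, f4]
  fin_cases i <;> simp <;> ring

theorem isInfinitesimalSymmetry_iff_mem_span (X : SmoothVF) :
    IsInfinitesimalSymmetry lam0 ups0 X ↔ X ∈ Submodule.span ℝ (Set.range field) := by
  rw [isInfinitesimalSymmetry_iff, mem_span_field_iff]
  constructor
  · rintro ⟨h1, h2⟩
    -- Subtracting the combination with the same jet leaves a contact field whose Hamiltonian is a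
    -- solution with zero jet.
    refine ⟨jet (hamiltonian X), (sub_eq_zero.1 ((h1.sub (isContact_comb _)).eq_zero ?_)).symm⟩
    rw [map_sub, hamiltonian_comb]
    refine (h2.sub (isSol_combHam _)).eq_zero_of_jet ?_
    rw [jet_sub, jet_combHam, sub_self]
  · rintro ⟨c, rfl⟩
    refine ⟨isContact_comb c, ?_⟩
    rw [hamiltonian_comb]
    exact isSol_combHam c

theorem comb_injective : Function.Injective comb := fun c d h => by
  rw [← jet_combHam c, ← jet_combHam d, ← hamiltonian_comb, ← hamiltonian_comb, h]

/-! ### Coordinates on the split real form of `𝔤₂` -/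

/-- The element of `𝔤₂` which acts on the chart by the field with given coefficients. -/
def g2Matrix (c : Fin 14 → ℝ) : Matrix (Fin 7) (Fin 7) ℝ :=
  !![(c 6 + 2 * c 10) / 3, -2 / 3 * c 3, -2 / 3 * c 5, c 2 / 3, -c 1, c 0, 0;
    -c 8 / 6, (2 * c 6 + c 10) / 3, c 7 / 2, -c 5 / 3, -c 2 / 12, 0, -c 0;
    c 12 / 2, -c 4, (c 10 - c 6) / 3, c 3 / 3, 0, c 2 / 12, c 1;
    -c 11, 2 * c 12, 2 / 3 * c 8, 0, -c 3 / 3, c 5 / 3, -c 2 / 3;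
    -c 9, 2 * c 11, 0, -2 / 3 * c 8, (c 6 - c 10) / 3, -c 7 / 2, 2 / 3 * c 5;
    -c 13, 0, -2 * c 11, -2 * c 12, c 4, -(2 * c 6 + c 10) / 3, 2 / 3 * c 3;
    0, c 13, c 9, c 11, -c 12 / 2, c 8 / 6, -(c 6 + 2 * c 10) / 3]

/-- The coefficients of an element of `𝔤₂`. -/
def g2Coeff (A : Matrix (Fin 7) (Fin 7) ℝ) : Fin 14 → ℝ :=
  ![A 0 5, -A 0 4, 3 * A 0 3, -3 / 2 * A 0 1, -A 2 1, -3 / 2 * A 0 2, 2 * A 1 1 - A 0 0, 2 * A 1 2,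
    -6 * A 1 0, -A 4 0, 2 * A 0 0 - A 1 1, -A 3 0, 2 * A 2 0, -A 5 0]

theorem g2Coeff_g2Matrix (c : Fin 14 → ℝ) : g2Coeff (g2Matrix c) = c := by
  ext i
  fin_cases i <;> simp [g2Coeff, g2Matrix] <;> ring

set_option maxHeartbeats 1000000 in
theorem g2Matrix_mem (c : Fin 14 → ℝ) : g2Matrix c ∈ splitG2 := by
  intro u v w
  simp only [Phi, wedge3, Matrix.det_fin_three, g2Matrix, Matrix.mulVec, dotProduct,
    Fin.sum_univ_seven, Matrix.of_apply, Matrix.cons_val]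
  ring

set_option maxHeartbeats 4000000 in
theorem g2Matrix_g2Coeff {A : Matrix (Fin 7) (Fin 7) ℝ} (hA : A ∈ splitG2) :
    g2Matrix (g2Coeff A) = A := by
  have h := fun i j k : Fin 7 => hA (Pi.single i 1) (Pi.single j 1) (Pi.single k 1)
  simp only [Phi, wedge3, Matrix.det_fin_three, Matrix.of_apply, Matrix.cons_val,
    Matrix.mulVec_single_one, Matrix.col_apply, Pi.single_apply] at h
  -- The invariance condition is alternating, so the 35 triples i < j < k contain all of it: 35
  -- linear equations on 49 entries, leaving the 14 parameters.
  have e012 := h 0 1 2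
  have e013 := h 0 1 3
  have e014 := h 0 1 4
  have e015 := h 0 1 5
  have e016 := h 0 1 6
  have e023 := h 0 2 3
  have e024 := h 0 2 4
  have e025 := h 0 2 5
  have e026 := h 0 2 6
  have e034 := h 0 3 4
  have e035 := h 0 3 5
  have e036 := h 0 3 6
  have e045 := h 0 4 5
  have e046 := h 0 4 6
  have e056 := h 0 5 6
  have e123 := h 1 2 3
  have e124 := h 1 2 4
  have e125 := h 1 2 5
  have e126 := h 1 2 6
  have e134 := h 1 3 4
  have e135 := h 1 3 5
  have e136 := h 1 3 6
  have e145 := h 1 4 5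
  have e146 := h 1 4 6
  have e156 := h 1 5 6
  have e234 := h 2 3 4
  have e235 := h 2 3 5
  have e236 := h 2 3 6
  have e245 := h 2 4 5
  have e246 := h 2 4 6
  have e256 := h 2 5 6
  have e345 := h 3 4 5
  have e346 := h 3 4 6
  have e356 := h 3 5 6
  have e456 := h 4 5 6
  simp at e012
  simp at e013
  simp at e014
  simp at e015
  simp at e016
  simp at e023
  simp at e024
  simp at e025
  simp at e026
  simp at e034
  simp at e035
  simp at e036
  simp at e045
  simp at e046
  simp at e056
  simp at e123
  simp at e124
  simp at e125
  simp at e126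
  simp at e134
  simp at e135
  simp at e136
  simp at e145
  simp at e146
  simp at e156
  simp at e234
  simp at e235
  simp at e236
  simp at e245
  simp at e246
  simp at e256
  simp at e345
  simp at e346
  simp at e356
  simp at e456
  clear h hA
  ext i j
  fin_cases i <;> fin_cases j <;> simp [g2Matrix, g2Coeff] <;> linarith

/-! ### The action of `𝔤₂` on the chart of `G₂/P̄` -/

/-- The two vectors spanning the plane with given coordinates, as the columns of a matrix. -/
def planeFrame : Matrix (Fin 7) (Fin 2) Smooth :=
  !![1, 0;
    0, 1;
    (-1 / 2 : ℝ) • coord 2, coord 1;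
    coord 3, (-2 : ℝ) • coord 2;
    coord 4, (-2 : ℝ) • coord 3;
    coord 0 - coord 2 * coord 3, (2 : ℝ) • (coord 1 * coord 3) - (2 : ℝ) • coord 2 ^ 2;
    (1 / 2 : ℝ) • (coord 2 * coord 4) - (1 / 2 : ℝ) • coord 3 ^ 2,
      -coord 0 + (2 : ℝ) • (coord 2 * coord 3) - coord 1 * coord 4]

/-- A constant matrix as a matrix of smooth functions. -/
def constMatrix (A : Matrix (Fin 7) (Fin 7) ℝ) : Matrix (Fin 7) (Fin 7) Smooth :=
  A.map (algebraMap ℝ Smooth)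

/-- The vector field `V` moves the planes in the chart as the linear vector field `-A` does. -/
def Realizes (V : SmoothVF) (A : Matrix (Fin 7) (Fin 7) ℝ) : Prop :=
  ∃ τ : Matrix (Fin 2) (Fin 2) Smooth,
    planeFrame.map (der V) = planeFrame * τ - constMatrix A * planeFrame

theorem map_der_mul {l m n : Type*} [Fintype m] (V : SmoothVF) (M : Matrix l m Smooth)
    (N : Matrix m n Smooth) : (M * N).map (der V) = M.map (der V) * N + M * N.map (der V) := by
  ext i j : 1
  simp only [Matrix.map_apply, Matrix.mul_apply, map_sum, Derivation.leibniz, Matrix.add_apply,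
    smul_eq_mul, ← Finset.sum_add_distrib]
  exact Finset.sum_congr rfl fun k _ => by ring

theorem map_der_sub {m n : Type*} (V : SmoothVF) (M N : Matrix m n Smooth) :
    (M - N).map (der V) = M.map (der V) - N.map (der V) := by
  ext i j : 1
  simp

theorem map_der_constMatrix (V : SmoothVF) (A : Matrix (Fin 7) (Fin 7) ℝ) :
    (constMatrix A).map (der V) = 0 := by
  ext i j : 1
  simp [constMatrix]

theorem constMatrix_lie (A B : Matrix (Fin 7) (Fin 7) ℝ) :
    constMatrix ⁅A, B⁆ = constMatrix A * constMatrix B - constMatrix B * constMatrix A := by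
  rw [Ring.lie_def]
  simp only [constMatrix, ← Matrix.map_mul]
  exact Matrix.map_sub _ (map_sub _) _ _

/-- With F = `planeFrame`, VF = Fσ - AF and WF = Fτ - BF, the mixed terms AFτ and BFσ cancel in
V(WF) - W(VF), leaving (BA - AB)F modulo the columns of F. The minus sign in `Realizes` is what
makes this -[A, B]F. -/
theorem Realizes.lie {V W : SmoothVF} {A B : Matrix (Fin 7) (Fin 7) ℝ} (hV : Realizes V A)
    (hW : Realizes W B) : Realizes ⁅V, W⁆ ⁅A, B⁆ := by
  obtain ⟨σ, hσ⟩ := hV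
  obtain ⟨τ, hτ⟩ := hW
  have e : planeFrame.map (der ⁅V, W⁆)
      = (planeFrame.map (der W)).map (der V) - (planeFrame.map (der V)).map (der W) := by
    ext i j : 1
    simp [der_lie]
  refine ⟨σ * τ - τ * σ + τ.map (der V) - σ.map (der W), ?_⟩
  rw [e, hσ, hτ, map_der_sub, map_der_sub, map_der_mul, map_der_mul, map_der_mul, map_der_mul,
    map_der_constMatrix, map_der_constMatrix, hσ, hτ, constMatrix_lie]
  simp only [Matrix.mul_sub, Matrix.sub_mul, Matrix.mul_add, Matrix.mul_assoc, Matrix.zero_mul]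
  abel

/-- The top block of `planeFrame` is the identity, so its derivatives vanish and the two
reparametrizations of the plane agree. The other entries recover all coordinates. -/
theorem Realizes.unique {V W : SmoothVF} {A : Matrix (Fin 7) (Fin 7) ℝ} (hV : Realizes V A)
    (hW : Realizes W A) : V = W := by
  obtain ⟨σ, hσ⟩ := hV
  obtain ⟨τ, hτ⟩ := hW
  have e : planeFrame.map (der V) - planeFrame.map (der W) = planeFrame * (σ - τ) := by
    rw [hσ, hτ, Matrix.mul_sub]
    abel
  have h0 : σ - τ = 0 := by
    ext i j : 1
    have h := congrFun (congrFun e (Fin.castLE (by omega) i)) j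
    fin_cases i <;> fin_cases j <;>
      simpa [planeFrame, Matrix.mul_apply, Fin.sum_univ_two] using h.symm
  rw [h0, Matrix.mul_zero] at e
  have d : ∀ i j, der V (planeFrame i j) = der W (planeFrame i j) := fun i j =>
    sub_eq_zero.1 (congrFun (congrFun e i) j)
  have h1 : comp V 1 = comp W 1 := by simpa [planeFrame] using d 2 1
  have h3 : comp V 3 = comp W 3 := by simpa [planeFrame] using d 3 0
  have h4 : comp V 4 = comp W 4 := by simpa [planeFrame] using d 4 0
  have h2 : comp V 2 = comp W 2 := by simpa [planeFrame] using d 2 0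
  have h5 : comp V 0 = comp W 0 := by simpa [planeFrame, h2, h3] using d 5 0
  refine smoothVF_ext fun i => ?_
  fin_cases i
  exacts [h5, h1, h2, h3, h4]

theorem comp_comb_zero (c : Fin 14 → ℝ) :
    comp (comb c) 0 = combHam c + (3 : ℝ) • (coord 2 * comb3 c) - coord 1 * comb4 c := by
  rw [← hamiltonian_comb, hamiltonian_eq, comp_comb_three, comp_comb_four]
  abel

/-- The constant top block forces τ to consist of the first two rows of A times `planeFrame`. -/
theorem realizes_of_entries {V : SmoothVF} {A : Matrix (Fin 7) (Fin 7) ℝ}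
    (h : ∀ i j, der V (planeFrame i j) = planeFrame i 0 * ∑ k, A 0 k • planeFrame k j
      + planeFrame i 1 * ∑ k, A 1 k • planeFrame k j - ∑ k, A i k • planeFrame k j) :
    Realizes V A := by
  refine ⟨!![∑ k, A 0 k • planeFrame k 0, ∑ k, A 0 k • planeFrame k 1;
    ∑ k, A 1 k • planeFrame k 0, ∑ k, A 1 k • planeFrame k 1], ?_⟩
  ext i j : 1
  have e : (constMatrix A * planeFrame) i j = ∑ k, A i k • planeFrame k j := by
    simp only [constMatrix, Matrix.mul_apply, Matrix.map_apply, Algebra.smul_def]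
  rw [Matrix.map_apply, h, Matrix.sub_apply, e, Matrix.mul_apply, Fin.sum_univ_two]
  fin_cases j <;> rfl

set_option maxHeartbeats 4000000 in
theorem realizes_comb (c : Fin 14 → ℝ) : Realizes (comb c) (g2Matrix c) := by
  refine realizes_of_entries fun i j => ?_
  simp only [Fin.sum_univ_seven]
  ext x
  fin_cases i <;> fin_cases j <;>
    simp [planeFrame, comp_comb_zero, comp_comb_one, comp_comb_two, comp_comb_three,
      comp_comb_four, g2Matrix, combHam, comb1, comb2, comb3, comb4, heightY] <;> ring

/-! ### The Lie algebra of symmetries -/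

theorem realizes_comb_g2Coeff {A : Matrix (Fin 7) (Fin 7) ℝ} (hA : A ∈ splitG2) :
    Realizes (comb (g2Coeff A)) A := by
  have h := realizes_comb (g2Coeff A)
  rwa [g2Matrix_g2Coeff hA] at h

/-- The action of `𝔤₂` on the chart by vector fields. -/
def g2Action : splitG2 →ₗ⁅ℝ⁆ SmoothVF where
  toFun A := comb (g2Coeff A)
  map_add' A B := by
    have : g2Coeff ((A + B : splitG2) : Matrix (Fin 7) (Fin 7) ℝ)
        = g2Coeff A.1 + g2Coeff B.1 := by
      ext i
      fin_cases i <;> simp [g2Coeff] <;> ring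
    rw [this]
    simp [comb, add_smul, Finset.sum_add_distrib]
  map_smul' r A := by
    have : g2Coeff ((r • A : splitG2) : Matrix (Fin 7) (Fin 7) ℝ) = r • g2Coeff A.1 := by
      ext i
      fin_cases i <;> simp [g2Coeff] <;> ring
    rw [this]
    simp [comb, mul_smul, Finset.smul_sum]
  -- Both sides realize the matrix ⁅A, B⁆, hence coincide.
  map_lie' {A B} := (realizes_comb_g2Coeff (⁅A, B⁆ : splitG2).2).unique
    ((realizes_comb_g2Coeff A.2).lie (realizes_comb_g2Coeff B.2))

theorem g2Action_apply (A : splitG2) : g2Action A = comb (g2Coeff A) := rfl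

theorem g2Action_injective : Function.Injective g2Action := fun A B h => by
  have := comb_injective h
  ext1
  rw [← g2Matrix_g2Coeff A.2, this, g2Matrix_g2Coeff B.2]

theorem g2Action_range_toSubmodule :
    g2Action.range.toSubmodule = Submodule.span ℝ (Set.range field) := by
  ext X
  rw [mem_span_field_iff, LieSubalgebra.mem_toSubmodule, LieHom.mem_range]
  constructor
  · rintro ⟨A, rfl⟩
    exact ⟨_, rfl⟩
  · rintro ⟨c, rfl⟩
    exact ⟨⟨g2Matrix c, g2Matrix_mem c⟩, by rw [g2Action_apply, g2Coeff_g2Matrix]⟩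

theorem lieSpan_field : LieSubalgebra.lieSpan ℝ SmoothVF (Set.range field) = g2Action.range := by
  refine le_antisymm (LieSubalgebra.lieSpan_le.2 ?_) ?_
  · intro X hX
    rw [SetLike.mem_coe, ← LieSubalgebra.mem_toSubmodule, g2Action_range_toSubmodule]
    exact Submodule.subset_span hX
  · rw [← LieSubalgebra.toSubmodule_le_toSubmodule, g2Action_range_toSubmodule]
    exact Submodule.span_le.2 LieSubalgebra.subset_lieSpan

theorem nonempty_lieEquiv_splitG2 :
    Nonempty (LieSubalgebra.lieSpan ℝ SmoothVF (Set.range field) ≃ₗ⁅ℝ⁆ splitG2) := by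
  rw [lieSpan_field]
  exact ⟨(LieEquiv.ofInjective g2Action g2Action_injective).symm⟩

/-! ### The `G₂`-contact structure -/

theorem contDiff_lam0 : ContDiff ℝ ∞ lam0 := by
  unfold lam0
  fun_prop

theorem dOneForm_lam0 (x u v : R5) :
    dOneForm lam0 x u v = u 1 * v 4 - v 1 * u 4 - 3 * (u 2 * v 3 - v 2 * u 3) := by
  have h : ∀ a b : R5, fderiv ℝ lam0 x a b = -3 * a 2 * b 3 + a 1 * b 4 := fun a b => by
    have e := fderiv_clm_apply (𝕜 := ℝ) (c := lam0) (u := fun _ => b) (x := x)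
      (contDiff_lam0.differentiable (by simp) x) (differentiableAt_const b)
    have e' := congrArg (fun L : R5 →L[ℝ] ℝ => L a) e
    simp only [fderiv_lam0_apply] at e'
    simpa using e'.symm
  rw [dOneForm, h, h]
  ring

theorem isG2ContactStructure : IsG2ContactStructure lam0 ups0 := by
  refine ⟨contDiff_lam0, by unfold ups0; fun_prop, fun p => ⟨Set.univ, isOpen_univ, trivial,
    ![fun _ => ![0, 1, 0, 0, 0], fun _ => ![0, 0, 1, 0, 0], fun x => ![3 * x 2, 0, 0, 1, 0],
      fun x => ![-x 1, 0, 0, 0, 1]], ?_, ?_⟩⟩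
  · intro i
    refine ContDiff.contDiffOn ?_
    rw [contDiff_pi]
    intro j
    fin_cases i <;> fin_cases j <;> simp <;> fun_prop
  · intro x _
    -- The discriminant of the cubic with coefficients a₀, 3a₁, 3a₂, a₃ is -27 times Υ₀ on the frame
    -- `D1`, …, `D4`; the skew form needs no rescaling.
    refine ⟨fun h => ?_, ?_, ?_, ⟨-1 / 27, by norm_num, ?_⟩, ⟨1, one_ne_zero, ?_⟩⟩
    · have := congrArg (fun L : R5 →L[ℝ] ℝ => L (Pi.single 0 1)) h
      simp [lam0] at this
    · rw [Fintype.linearIndependent_iff]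
      intro a h i
      have h1 := congrFun h 1
      have h2 := congrFun h 2
      have h3 := congrFun h 3
      have h4 := congrFun h 4
      simp [Fin.sum_univ_four] at h1 h2 h3 h4
      fin_cases i
      exacts [h1, h2, h3, h4]
    · intro i
      rw [lam0_apply]
      fin_cases i <;> simp
    · intro a
      simp [ups0, Cubic.discr, Fin.sum_univ_four]
      ring
    · intro a b
      rw [dOneForm_lam0]
      simp [Fin.sum_univ_four]
      ring

/-! ### Flatness -/

open Matrix

/-- The unipotent element of `G₂` moving `span(e₁, e₂)` to the plane with coordinates `x`. -/
def sectionMatrix (x : R5) : Matrix (Fin 7) (Fin 7) ℝ :=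
  !![1, 0, 0, 0, 0, 0, 0;
    0, 1, 0, 0, 0, 0, 0;
    -1 / 2 * x 2, x 1, 1, 0, 0, 0, 0;
    x 3, -2 * x 2, 0, 1, 0, 0, 0;
    x 4, -2 * x 3, 0, 0, 1, 0, 0;
    x 0 - x 2 * x 3, 2 * (x 1 * x 3) - 2 * x 2 ^ 2, 2 * x 3, 2 * x 2, -x 1, 1, 0;
    1 / 2 * (x 2 * x 4) - 1 / 2 * x 3 ^ 2, -x 0 + 2 * (x 2 * x 3) - x 1 * x 4, -x 4, -x 3,
      1 / 2 * x 2, 0, 1]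

/-- The inverse of `sectionMatrix`. -/
def sectionMatrixInv (x : R5) : Matrix (Fin 7) (Fin 7) ℝ :=
  !![1, 0, 0, 0, 0, 0, 0;
    0, 1, 0, 0, 0, 0, 0;
    1 / 2 * x 2, -x 1, 1, 0, 0, 0, 0;
    -x 3, 2 * x 2, 0, 1, 0, 0, 0;
    -x 4, 2 * x 3, 0, 0, 1, 0, 0;
    -x 0 - x 1 * x 4 + 2 * (x 2 * x 3), 2 * (x 1 * x 3) - 2 * x 2 ^ 2, -2 * x 3, -2 * x 2, x 1, 1,
      0;
    1 / 2 * (x 2 * x 4) - 1 / 2 * x 3 ^ 2, x 0 - x 2 * x 3, x 4, x 3, -1 / 2 * x 2, 0, 1]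

theorem sectionMatrix_mul_inv (x : R5) : sectionMatrix x * sectionMatrixInv x = 1 := by
  ext i j
  simp only [Matrix.mul_apply, Fin.sum_univ_seven]
  fin_cases i <;> fin_cases j <;> simp [sectionMatrix, sectionMatrixInv] <;> ring

/-- The local section of `G₂ → G₂/P̄`. -/
def localSection (x : R5) : GL (Fin 7) ℝ :=
  ⟨sectionMatrix x, sectionMatrixInv x, sectionMatrix_mul_inv x,
    mul_eq_one_comm.1 (sectionMatrix_mul_inv x)⟩

set_option maxHeartbeats 4000000 in
theorem localSection_mem (x : R5) : localSection x ∈ G2Group := by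
  intro u v w
  change Phi (sectionMatrix x *ᵥ u) (sectionMatrix x *ᵥ v) (sectionMatrix x *ᵥ w) = Phi u v w
  simp only [Phi, wedge3, Matrix.det_fin_three, sectionMatrix, Matrix.mulVec, dotProduct,
    Fin.sum_univ_seven, Matrix.of_apply, Matrix.cons_val]
  ring

theorem Hform_sectionMatrix (x : R5) (u v : V7) :
    Hform (sectionMatrix x *ᵥ u) (sectionMatrix x *ᵥ v) = Hform u v := by
  simp only [Hform, sectionMatrix, Matrix.mulVec, dotProduct, Fin.sum_univ_seven, Matrix.of_apply,
    Matrix.cons_val]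
  ring

theorem sectionMatrix_mulVec_inv (x : R5) (u : V7) :
    sectionMatrix x *ᵥ (sectionMatrixInv x *ᵥ u) = u := by
  rw [Matrix.mulVec_mulVec, sectionMatrix_mul_inv, Matrix.one_mulVec]

theorem sectionMatrix_apply (x : R5) (i : Fin 7) (j : Fin 2) :
    sectionMatrix x i (Fin.castLE (by omega) j) = planeFrame i j x := by
  fin_cases j <;> fin_cases i <;> simp [sectionMatrix, planeFrame]

/-- The derivative of the first column of `sectionMatrix`. -/
def dFirst (x v : R5) : V7 :=
  ![0, 0, -1 / 2 * v 2, v 3, v 4, v 0 - v 2 * x 3 - x 2 * v 3,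
    1 / 2 * (x 2 * v 4 + v 2 * x 4) - x 3 * v 3]

/-- The derivative of the second column of `sectionMatrix`. -/
def dSecond (x v : R5) : V7 :=
  ![0, 0, v 1, -2 * v 2, -2 * v 3, 2 * (v 1 * x 3 + x 1 * v 3) - 4 * x 2 * v 2,
    -v 0 - v 1 * x 4 - x 1 * v 4 + 2 * (v 2 * x 3 + x 2 * v 3)]

/-- Only the action of the Maurer–Cartan form on E' matters for flatness, and there it involves just
the two columns of `planeFrame`. -/
theorem maurerCartan_single (x v : R5) (j : Fin 2) :
    maurerCartan localSection x v *ᵥ Pi.single (Fin.castLE (by omega) j) 1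
      = sectionMatrixInv x *ᵥ fun i => fderiv ℝ (planeFrame i j : R5 → ℝ) x v := by
  rw [maurerCartan, ← Matrix.mulVec_mulVec, Matrix.mulVec_single_one]
  change sectionMatrixInv x *ᵥ _ = _
  congr 1
  ext i
  rw [Matrix.col_apply, Matrix.of_apply]
  have : (fun y => (localSection y).1 i (Fin.castLE (by omega) j)) = (planeFrame i j : R5 → ℝ) :=
    funext fun y => sectionMatrix_apply y i j
  rw [this]

theorem maurerCartan_first (x v : R5) : maurerCartan localSection x v *ᵥ Pi.single 0 1
    = sectionMatrixInv x *ᵥ dFirst x v := by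
  rw [show dFirst x v = fun i => fderiv ℝ (planeFrame i 0 : R5 → ℝ) x v from ?_]
  · exact maurerCartan_single x v 0
  · ext i
    rw [fderiv_eq_sum, Fin.sum_univ_five]
    fin_cases i <;> simp [dFirst, planeFrame] <;> ring

theorem maurerCartan_second (x v : R5) : maurerCartan localSection x v *ᵥ Pi.single 1 1
    = sectionMatrixInv x *ᵥ dSecond x v := by
  rw [show dSecond x v = fun i => fderiv ℝ (planeFrame i 1 : R5 → ℝ) x v from ?_]
  · exact maurerCartan_single x v 1
  · ext i
    rw [fderiv_eq_sum, Fin.sum_univ_five]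
    fin_cases i <;> simp [dSecond, planeFrame] <;> ring

theorem mem_planeE_iff (u : V7) :
    u ∈ planeE ↔ ∃ a b : ℝ, a • (Pi.single 0 1 : V7) + b • (Pi.single 1 1 : V7) = u :=
  Submodule.mem_span_pair

/-- Such a d is a combination of the first two columns of the section; their top block is the
identity, so the first two entries of d are its coefficients. -/
theorem eq_zero_of_inv_mulVec_mem_planeE {x : R5} {d : V7} (h : sectionMatrixInv x *ᵥ d ∈ planeE)
    (h0 : d 0 = 0) (h1 : d 1 = 0) : d = 0 := by
  obtain ⟨a, b, h⟩ := (mem_planeE_iff _).1 h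
  have e := congrArg (sectionMatrix x *ᵥ ·) h
  simp only [sectionMatrix_mulVec_inv] at e
  have ha := congrFun e 0
  have hb := congrFun e 1
  rw [h0] at ha
  rw [h1] at hb
  simp [sectionMatrix, Matrix.mulVec_add, Matrix.mulVec_smul] at ha hb
  rw [← e, ha, hb]
  simp

theorem eq_zero_of_inPBar {x v : R5} (h : InPBar (maurerCartan localSection x v)) : v = 0 := by
  have h1 := h (Pi.single 0 1) (Submodule.subset_span (by simp))
  have h2 := h (Pi.single 1 1) (Submodule.subset_span (by simp))
  rw [maurerCartan_first] at h1
  rw [maurerCartan_second] at h2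
  have d1 := eq_zero_of_inv_mulVec_mem_planeE h1 rfl rfl
  have d2 := eq_zero_of_inv_mulVec_mem_planeE h2 rfl rfl
  have e2 := congrFun d1 2
  have e3 := congrFun d1 3
  have e4 := congrFun d1 4
  have e0 := congrFun d1 5
  have e1 := congrFun d2 2
  simp [dFirst] at e2 e3 e4 e0
  simp [dSecond] at e1
  rw [e2, e3] at e0
  ext i
  fin_cases i
  exacts [by simpa using e0, e1, e2, e3, e4]

/-- Invariance of H under the section removes the inverse matrix. The form obtained on E' is skew,
as E' is null, so it has a single coefficient, and that is λ₀. -/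
theorem Hform_maurerCartan (x v : R5) (a b c d : ℝ) :
    Hform (maurerCartan localSection x v *ᵥ
        (a • (Pi.single 0 1 : V7) + b • (Pi.single 1 1 : V7)))
      (c • (Pi.single 0 1 : V7) + d • (Pi.single 1 1 : V7)) = (b * c - a * d) * lam0 x v := by
  rw [Matrix.mulVec_add, Matrix.mulVec_smul, Matrix.mulVec_smul, maurerCartan_first,
    maurerCartan_second, ← Matrix.mulVec_smul, ← Matrix.mulVec_smul, ← Matrix.mulVec_add,
    ← Hform_sectionMatrix x, sectionMatrix_mulVec_inv, Matrix.mulVec_add, Matrix.mulVec_smul,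
    Matrix.mulVec_smul, Matrix.mulVec_single_one, Matrix.mulVec_single_one, lam0_apply]
  simp [Hform, dFirst, dSecond, sectionMatrix]
  ring

theorem inGMinusOne_iff (x v : R5) :
    lam0 x v = 0 ↔ InGMinusOne (maurerCartan localSection x v) := by
  constructor
  · intro h u hu w hw
    obtain ⟨a, b, rfl⟩ := (mem_planeE_iff _).1 hu
    obtain ⟨c, d, rfl⟩ := (mem_planeE_iff _).1 hw
    rw [Hform_maurerCartan, h, mul_zero]
  · intro h
    have e := h _ ((mem_planeE_iff _).2 ⟨0, 1, rfl⟩) _ ((mem_planeE_iff _).2 ⟨1, 0, rfl⟩)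
    rw [Hform_maurerCartan] at e
    simpa using e

/-- The quadratic form u ↦ H(Au, Au) on E' has coefficients v₂v₄ - v₃², v₂v₃ - v₁v₄ and 4(v₁v₃ -
v₂²): up to a linear change of variables it is the Hessian of the cubic with coefficients v₁, 3v₂,
3v₃, v₄, and the discriminant of the Hessian is a multiple of that of the cubic. -/
theorem modelQuartic_maurerCartan (x v : R5) :
    modelQuartic (maurerCartan localSection x v) = -ups0 x v := by
  have h : ∀ a b : V7, Hform (sectionMatrixInv x *ᵥ a) (sectionMatrixInv x *ᵥ b) = Hform a b :=
    fun a b => by rw [← Hform_sectionMatrix x, sectionMatrix_mulVec_inv, sectionMatrix_mulVec_inv]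
  simp only [modelQuartic, maurerCartan_first, maurerCartan_second, h]
  simp [Hform, dFirst, dSecond, ups0]
  ring

theorem isFlat : IsFlat lam0 ups0 := by
  refine fun p => ⟨Set.univ, isOpen_univ, trivial, localSection, fun x _ => localSection_mem x,
    fun i j => ContDiff.contDiffOn ?_, fun x _ => ⟨fun v => eq_zero_of_inPBar, inGMinusOne_iff x,
      -1, by norm_num, fun v _ => by rw [modelQuartic_maurerCartan]; ring⟩⟩
  change ContDiff ℝ ∞ fun x => sectionMatrix x i j
  fin_cases i <;> fin_cases j <;> simp [sectionMatrix] <;> fun_prop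

end G2Contact
end

open G2Contact in
theorem proposition4p4 :
    (∀ X : SmoothVF, IsInfinitesimalSymmetry lam0 ups0 X ↔
      X ∈ Submodule.span ℝ (Set.range field)) ∧
    (LieSubalgebra.lieSpan ℝ SmoothVF (Set.range field)).toSubmodule =
      Submodule.span ℝ (Set.range field) ∧
    Nonempty (LieSubalgebra.lieSpan ℝ SmoothVF (Set.range field) ≃ₗ⁅ℝ⁆ splitG2) ∧
    IsG2ContactStructure lam0 ups0 ∧
    IsFlat lam0 ups0 :=
  ⟨isInfinitesimalSymmetry_iff_mem_span, by rw [lieSpan_field, g2Action_range_toSubmodule],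
    nonempty_lieEquiv_splitG2, isG2ContactStructure, isFlat⟩
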